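/- Let $K$ be a field and let $\mathbb{S}_1 = K\langle x, y \mid yx = 1\rangle$ be the algebra of one-sided inverses of the polynomial algebra in one variable. For a ring $R$, let $M_\infty(R)=\bigoplus_{i,j\in\mathbb{N}} R E_{ij}$ be the ring (without $1$) of infinite matrices with finitely many nonzero entries, let $\mathrm{GL}_\infty(R)$ be the group of units of the multiplicative monoid $1+M_\infty(R)$, let $E_\infty(R)$ be the (normal) subgroup of $\mathrm{GL}_\infty(R)$ generated by all the elementary matrices $1+rE_{ij}$ ($i\neq j$, $r\in R$), and let $\mathrm{K}_1(R):=\mathrm{GL}_\infty(R)/E_\infty(R)$. Let $U(K):=\{\lambda E_{00}+1-E_{00} \mid \lambda\in K^*\}\subseteq \mathrm{GL}_\infty(\mathbb{S}_1)$. **Theorem.** $\mathrm{K}_1(\mathbb{S}_1)\simeq U(K)\simeq K^*$, where the isomorphisms are the natural ones: $U(K)\to \mathrm{K}_1(\mathbb{S}_1)$, $u\mapsto u\,E_\infty(\mathbb{S}_1)$, and $K^*\to U(K)$, $\lambda\mapsto \lambda E_{00}+1-E_{00}$. Moreover, $\mathrm{GL}_\infty(\mathbb{S}_1)=U(K)\ltimes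 E_\infty(\mathbb{S}_1)$, i.e. $E_\infty(\mathbb{S}_1)$ is a normal subgroup of $\mathrm{GL}_\infty(\mathbb{S}_1)$, and every element of $\mathrm{GL}_\infty(\mathbb{S}_1)$ is a unique product $ue$ with $u\in U(K)$ and $e\in E_\infty(\mathbb{S}_1)$. -/

import Mathlib

noncomputable section

/-! # The algebra of one-sided inverses, `GL_∞(R)`, `E_∞(R)` and `K₁(R)` -/

/-- The defining relation `y x = 1`; the generator `x` is indexed by `false` and `y` by `true`. -/
inductive OneSidedInverseRel (K : Type*) [Field K] :
    FreeAlgebra K Bool → FreeAlgebra K Bool → Prop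
  | yx : OneSidedInverseRel K (FreeAlgebra.ι K true * FreeAlgebra.ι K false) 1

/-- The algebra `𝕊₁ = K⟨x, y | y x = 1⟩` of one-sided inverses of the polynomial algebra in one
variable. -/
abbrev OneSidedInverseAlg (K : Type*) [Field K] : Type _ :=
  RingQuot (OneSidedInverseRel K)

/-- The set `1 + M_∞(R)` of infinite matrices (indexed by `ℕ × ℕ`) that differ from the identity
matrix only inside some finite upper left corner. -/
@[ext]
structure OneAddMInf (R : Type*) [Ring R] where
  /-- the underlying infinite matrix -/
  val : Matrix ℕ ℕ R
  /-- outside a finite corner the matrix is the identity matrix -/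
  finitary : ∃ n : ℕ, ∀ i j : ℕ, (n ≤ i ∨ n ≤ j) → val i j = (1 : Matrix ℕ ℕ R) i j

namespace OneAddMInf

variable {R : Type*} [Ring R]

/-- `A` agrees with the identity matrix outside its upper left `n × n` corner. -/
def Level (n : ℕ) (A : Matrix ℕ ℕ R) : Prop :=
  ∀ i j : ℕ, (n ≤ i ∨ n ≤ j) → A i j = (1 : Matrix ℕ ℕ R) i j

theorem Level.mono {n m : ℕ} {A : Matrix ℕ ℕ R} (h : Level n A) (hnm : n ≤ m) : Level m A :=
  fun i j hij => h i j (hij.imp hnm.trans hnm.trans)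

/-- The matrix product (only finitely many terms of each sum are non-zero for matrices in
`1 + M_∞(R)`). -/
def mulVal (A B : Matrix ℕ ℕ R) : Matrix ℕ ℕ R := fun i k => ∑ᶠ j, A i j * B j k

theorem mulVal_eq_sum {n : ℕ} {A : Matrix ℕ ℕ R} (hA : Level n A) (B : Matrix ℕ ℕ R)
    {i : ℕ} (hi : i < n) (k : ℕ) :
    mulVal A B i k = ∑ j ∈ Finset.range n, A i j * B j k := by
  unfold mulVal
  apply finsum_eq_sum_of_support_subset
  intro j hj
  by_contra hjn
  have hjn' : n ≤ j := by simpa using hjn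
  apply hj
  have : A i j = 0 := by
    rw [hA i j (Or.inr hjn'), Matrix.one_apply_ne (by omega)]
  simp [this]

theorem mulVal_level {n : ℕ} {A B : Matrix ℕ ℕ R} (hA : Level n A) (hB : Level n B) :
    Level n (mulVal A B) := by
  intro i k hik
  rcases lt_or_ge i n with hi | hi
  · have hk : n ≤ k := by omega
    rw [mulVal_eq_sum hA B hi, Matrix.one_apply_ne (by omega)]
    apply Finset.sum_eq_zero
    intro j hj
    have hj' : j < n := by simpa using hj
    rw [hB j k (Or.inr hk), Matrix.one_apply_ne (by omega), mul_zero]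
  · rw [mulVal_eq_sum (hA.mono (show n ≤ i + 1 by omega)) B (Nat.lt_succ_self i)]
    rw [Finset.sum_eq_single i]
    · rw [hA i i (Or.inl hi), hB i k (Or.inl hi)]; simp
    · intro j _ hj
      rw [hA i j (Or.inl hi), Matrix.one_apply_ne (Ne.symm hj), zero_mul]
    · simp

/-- The upper left `n × n` corner. -/
def corner (n : ℕ) (A : Matrix ℕ ℕ R) : Matrix (Fin n) (Fin n) R := fun i j => A i j

theorem corner_mulVal {n : ℕ} {A : Matrix ℕ ℕ R} (hA : Level n A) (B : Matrix ℕ ℕ R) :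
    corner n (mulVal A B) = corner n A * corner n B := by
  ext i k
  simp only [corner, Matrix.mul_apply]
  rw [mulVal_eq_sum hA B i.2, Finset.sum_range]

theorem corner_one (n : ℕ) : corner n (1 : Matrix ℕ ℕ R) = 1 := by
  ext i k
  simp [corner, Matrix.one_apply, Fin.ext_iff]

theorem level_one (n : ℕ) : Level n (1 : Matrix ℕ ℕ R) := fun _ _ _ => rfl

theorem eq_of_corner {n : ℕ} {A B : Matrix ℕ ℕ R} (hA : Level n A) (hB : Level n B)
    (h : corner n A = corner n B) : A = B := by
  ext i j
  by_cases hij : n ≤ i ∨ n ≤ j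
  · rw [hA i j hij, hB i j hij]
  · push Not at hij
    exact congrFun (congrFun h ⟨i, hij.1⟩) ⟨j, hij.2⟩

theorem exists_level (A : OneAddMInf R) : ∃ n, Level n A.val := A.finitary

/-- The multiplicative monoid `1 + M_∞(R)`. -/
instance : Monoid (OneAddMInf R) where
  one := ⟨1, 0, fun _ _ _ => rfl⟩
  mul A B := ⟨mulVal A.val B.val, by
    obtain ⟨n, hn⟩ := A.exists_level
    obtain ⟨m, hm⟩ := B.exists_level
    exact ⟨max n m, mulVal_level (hn.mono (le_max_left _ _)) (hm.mono (le_max_right _ _))⟩⟩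
  mul_assoc A B C := by
    obtain ⟨a, ha⟩ := A.exists_level
    obtain ⟨b, hb⟩ := B.exists_level
    obtain ⟨c, hc⟩ := C.exists_level
    have ha' := ha.mono (show a ≤ a + b + c by omega)
    have hb' := hb.mono (show b ≤ a + b + c by omega)
    have hc' := hc.mono (show c ≤ a + b + c by omega)
    apply OneAddMInf.ext
    change mulVal (mulVal A.val B.val) C.val = mulVal A.val (mulVal B.val C.val)
    apply eq_of_corner (mulVal_level (mulVal_level ha' hb') hc')
      (mulVal_level ha' (mulVal_level hb' hc'))
    rw [corner_mulVal (mulVal_level ha' hb'), corner_mulVal ha', corner_mulVal ha',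
      corner_mulVal hb', mul_assoc]
  one_mul A := by
    obtain ⟨a, ha⟩ := A.exists_level
    apply OneAddMInf.ext
    change mulVal 1 A.val = A.val
    apply eq_of_corner (mulVal_level (level_one a) ha) ha
    rw [corner_mulVal (level_one a), corner_one, one_mul]
  mul_one A := by
    obtain ⟨a, ha⟩ := A.exists_level
    apply OneAddMInf.ext
    change mulVal A.val 1 = A.val
    apply eq_of_corner (mulVal_level ha (level_one a)) ha
    rw [corner_mulVal ha, corner_one, mul_one]

theorem val_mul (A B : OneAddMInf R) : (A * B).val = mulVal A.val B.val := rfl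

theorem val_one : (1 : OneAddMInf R).val = 1 := rfl

theorem level_mul {n : ℕ} {A B : OneAddMInf R} (hA : Level n A.val) (hB : Level n B.val) :
    Level n (A * B).val := mulVal_level hA hB

theorem corner_mul {n : ℕ} {A B : OneAddMInf R} (hA : Level n A.val) :
    corner n (A * B).val = corner n A.val * corner n B.val := corner_mulVal hA _

/-- `1 + r E_{ij}` as an element of `1 + M_∞(R)`. -/
def oneAddSingle (i j : ℕ) (r : R) : OneAddMInf R :=
  ⟨1 + Matrix.single i j r, max i j + 1, fun p q h => by
    rw [Matrix.add_apply, Matrix.single_apply_of_ne (h := by omega), add_zero]⟩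

theorem level_oneAddSingle {n i j : ℕ} (hi : i < n) (hj : j < n) (r : R) :
    Level n (oneAddSingle i j r).val := fun p q h => by
  change (1 + Matrix.single i j r : Matrix ℕ ℕ R) p q = _
  rw [Matrix.add_apply, Matrix.single_apply_of_ne (h := by omega), add_zero]

theorem corner_oneAddSingle {n i j : ℕ} (hi : i < n) (hj : j < n) (r : R) :
    corner n (oneAddSingle i j r).val = 1 + Matrix.single ⟨i, hi⟩ ⟨j, hj⟩ r := by
  ext p q
  simp [corner, oneAddSingle, Matrix.one_apply, Matrix.single_apply, Fin.ext_iff]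

theorem oneAddSingle_mul_of_ne {i j : ℕ} (h : i ≠ j) (r s : R) :
    oneAddSingle i j r * oneAddSingle i j s = oneAddSingle i j (r + s) := by
  have hi : i < i + j + 1 := by omega
  have hj : j < i + j + 1 := by omega
  apply OneAddMInf.ext
  apply eq_of_corner (level_mul (level_oneAddSingle hi hj r) (level_oneAddSingle hi hj s))
    (level_oneAddSingle hi hj _)
  rw [corner_mul (level_oneAddSingle hi hj r)]
  simp only [corner_oneAddSingle hi hj]
  rw [Matrix.single_add, add_mul, mul_add, mul_add,
    Matrix.single_mul_single_of_ne _ _ _ _ (by simpa [Fin.ext_iff] using h.symm)]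
  simp only [mul_one, one_mul, add_zero]
  abel

theorem oneAddSingle_mul_same (i : ℕ) (r s : R) :
    oneAddSingle i i r * oneAddSingle i i s = oneAddSingle i i (r + s + r * s) := by
  have hi : i < i + 1 := by omega
  apply OneAddMInf.ext
  apply eq_of_corner (level_mul (level_oneAddSingle hi hi r) (level_oneAddSingle hi hi s))
    (level_oneAddSingle hi hi _)
  rw [corner_mul (level_oneAddSingle hi hi r)]
  simp only [corner_oneAddSingle hi hi]
  rw [Matrix.single_add, Matrix.single_add, add_mul, mul_add, mul_add,
    Matrix.single_mul_single_same]
  simp only [mul_one, one_mul]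
  abel

theorem oneAddSingle_zero (i j : ℕ) : oneAddSingle i j (0 : R) = 1 := by
  apply OneAddMInf.ext
  simp [oneAddSingle, val_one]

end OneAddMInf

/-- `GL_∞(R)`: the group of units of the monoid `1 + M_∞(R)`. -/
abbrev GLInf (R : Type*) [Ring R] : Type _ := (OneAddMInf R)ˣ

namespace GLInf

open OneAddMInf

variable {R : Type*} [Ring R]

/-- The elementary matrix `1 + r E_{ij}` with `i ≠ j`. -/
def elementary (i j : ℕ) (h : i ≠ j) (r : R) : GLInf R where
  val := oneAddSingle i j r
  inv := oneAddSingle i j (-r)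
  val_inv := by rw [oneAddSingle_mul_of_ne h, add_neg_cancel, oneAddSingle_zero]
  inv_val := by rw [oneAddSingle_mul_of_ne h, neg_add_cancel, oneAddSingle_zero]

variable (R) in
/-- `E_∞(R)`: the subgroup of `GL_∞(R)` generated by all the elementary matrices. -/
def E : Subgroup (GLInf R) :=
  Subgroup.closure {g | ∃ (i j : ℕ) (h : i ≠ j) (r : R), g = elementary i j h r}

/-- The homomorphism `μ : R* → GL_∞(R)`, `u ↦ u E₀₀ + 1 - E₀₀ = 1 + (u - 1) E₀₀`. -/
def mu : Rˣ →* GLInf R :=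
  Units.map
    { toFun := fun u => oneAddSingle 0 0 (u - 1)
      map_one' := by rw [sub_self, oneAddSingle_zero]
      map_mul' := fun u v => by rw [oneAddSingle_mul_same]; congr 1; noncomm_ring }

/-- Entrywise description of `μ(u) = u E₀₀ + 1 - E₀₀`. -/
theorem mu_val (u : Rˣ) :
    (mu u : OneAddMInf R).val = Matrix.single 0 0 (u : R) + 1 - Matrix.single 0 0 (1 : R) := by
  ext i j
  by_cases h : 0 = i ∧ 0 = j
  · simp [mu, oneAddSingle, Matrix.single_apply, h]; split_ifs <;> abel
  · simp [mu, oneAddSingle, h]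

theorem elementary_mem (i j : ℕ) (h : i ≠ j) (r : R) : elementary i j h r ∈ E R :=
  Subgroup.subset_closure ⟨i, j, h, r, rfl⟩

theorem exists_column (M : ℕ) (c : ℕ → R) (m : ℕ) (hm : m ≤ M) :
    ∃ T ∈ E R, Level (M + 1) (T : OneAddMInf R).val ∧
      corner (M + 1) (T : OneAddMInf R).val =
        1 + ∑ p : Fin (M + 1), if p.1 < m then Matrix.single p (Fin.last M) (c p) else 0 := by
  induction m with
  | zero => exact ⟨1, one_mem _, level_one _, by simp [val_one, corner_one]⟩
  | succ m ih =>
    obtain ⟨T, hT, hL, hC⟩ := ih (by omega)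
    have hmM : m ≠ M := by omega
    have h1 : m < M + 1 := by omega
    have h2 : M < M + 1 := by omega
    have hl := level_oneAddSingle h1 h2 (c m)
    refine ⟨elementary m M hmM (c m) * T, mul_mem (elementary_mem _ _ _ _) hT,
      level_mul hl hL, ?_⟩
    rw [Units.val_mul, corner_mul (A := ((elementary m M hmM (c m) : GLInf R) : OneAddMInf R)) hl,
      hC]
    change corner (M + 1) (oneAddSingle m M (c m)).val * _ = _
    rw [corner_oneAddSingle h1 h2]
    have key : (Matrix.single (⟨m, h1⟩ : Fin (M + 1)) (⟨M, h2⟩ : Fin (M + 1)) (c m)) *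
        (∑ p : Fin (M + 1), if p.1 < m then Matrix.single p (Fin.last M) (c p) else 0) = 0 := by
      rw [Finset.mul_sum]
      apply Finset.sum_eq_zero
      intro p _
      split_ifs with hp
      · exact Matrix.single_mul_single_of_ne _ _ _ _ (by simp [Fin.ext_iff]; omega) _
      · simp
    rw [add_mul, mul_add, mul_add, key]
    have split : (∑ p : Fin (M + 1), if p.1 < m + 1 then
          Matrix.single p (Fin.last M) (c p) else 0) =
        (∑ p : Fin (M + 1), if p.1 < m then Matrix.single p (Fin.last M) (c p) else 0) +
          Matrix.single (⟨m, h1⟩ : Fin (M + 1)) (⟨M, h2⟩ : Fin (M + 1)) (c m) := by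
      have h3 : ∑ p : Fin (M + 1), (if p = ⟨m, h1⟩ then Matrix.single p (Fin.last M) (c p) else 0) =
          Matrix.single (⟨m, h1⟩ : Fin (M + 1)) (⟨M, h2⟩ : Fin (M + 1)) (c m) := by
        rw [Finset.sum_ite_eq' Finset.univ (⟨m, h1⟩ : Fin (M + 1))]
        simp [Fin.last]
      rw [← h3, ← Finset.sum_add_distrib]
      apply Finset.sum_congr rfl
      intro p _
      rcases lt_trichotomy p.1 m with hp | hp | hp
      · simp [hp, hp.trans (Nat.lt_succ_self m), Fin.ext_iff, hp.ne]
      · simp [hp, Fin.ext_iff]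
      · simp [hp.ne', Fin.ext_iff, show ¬ p.1 < m + 1 by omega, show ¬ p.1 < m by omega]
    rw [split]
    simp only [mul_one, one_mul]
    abel

theorem exists_row (M : ℕ) (c : ℕ → R) (m : ℕ) (hm : m ≤ M) :
    ∃ T ∈ E R, Level (M + 1) (T : OneAddMInf R).val ∧
      corner (M + 1) (T : OneAddMInf R).val =
        1 + ∑ p : Fin (M + 1), if p.1 < m then Matrix.single (Fin.last M) p (c p) else 0 := by
  induction m with
  | zero => exact ⟨1, one_mem _, level_one _, by simp [val_one, corner_one]⟩
  | succ m ih =>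
    obtain ⟨T, hT, hL, hC⟩ := ih (by omega)
    have hmM : M ≠ m := by omega
    have h1 : m < M + 1 := by omega
    have h2 : M < M + 1 := by omega
    have hl := level_oneAddSingle h2 h1 (c m)
    refine ⟨T * elementary M m hmM (c m), mul_mem hT (elementary_mem _ _ _ _),
      level_mul hL hl, ?_⟩
    rw [Units.val_mul, corner_mul hL, hC]
    change _ * corner (M + 1) (oneAddSingle M m (c m)).val = _
    rw [corner_oneAddSingle h2 h1]
    have key : (∑ p : Fin (M + 1), if p.1 < m then Matrix.single (Fin.last M) p (c p) else 0) *
        (Matrix.single (⟨M, h2⟩ : Fin (M + 1)) (⟨m, h1⟩ : Fin (M + 1)) (c m)) = 0 := by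
      rw [Finset.sum_mul]
      apply Finset.sum_eq_zero
      intro p _
      split_ifs with hp
      · exact Matrix.single_mul_single_of_ne _ _ _ _ (by simp [Fin.ext_iff]; omega) _
      · simp
    rw [add_mul, mul_add, mul_add, key]
    have split : (∑ p : Fin (M + 1), if p.1 < m + 1 then
          Matrix.single (Fin.last M) p (c p) else 0) =
        (∑ p : Fin (M + 1), if p.1 < m then Matrix.single (Fin.last M) p (c p) else 0) +
          Matrix.single (⟨M, h2⟩ : Fin (M + 1)) (⟨m, h1⟩ : Fin (M + 1)) (c m) := by
      have h3 : ∑ p : Fin (M + 1), (if p = ⟨m, h1⟩ then Matrix.single (Fin.last M) p (c p) else 0) =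
          Matrix.single (⟨M, h2⟩ : Fin (M + 1)) (⟨m, h1⟩ : Fin (M + 1)) (c m) := by
        rw [Finset.sum_ite_eq' Finset.univ (⟨m, h1⟩ : Fin (M + 1))]
        simp [Fin.last]
      rw [← h3, ← Finset.sum_add_distrib]
      apply Finset.sum_congr rfl
      intro p _
      rcases lt_trichotomy p.1 m with hp | hp | hp
      · simp [hp, hp.trans (Nat.lt_succ_self m), Fin.ext_iff, hp.ne]
      · simp [hp, Fin.ext_iff]
      · simp [hp.ne', Fin.ext_iff, show ¬ p.1 < m + 1 by omega, show ¬ p.1 < m by omega]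
    rw [split]
    simp only [mul_one, one_mul]
    abel

theorem conj_elementary_mem (g : GLInf R) (i j : ℕ) (hij : i ≠ j) (r : R) :
    g * elementary i j hij r * g⁻¹ ∈ E R := by
  obtain ⟨a, ha⟩ := (g : OneAddMInf R).exists_level
  obtain ⟨b, hb⟩ := ((g⁻¹ : GLInf R) : OneAddMInf R).exists_level
  obtain ⟨M, haM, hbM, hiM, hjM⟩ : ∃ M, a ≤ M ∧ b ≤ M ∧ i < M ∧ j < M :=
    ⟨a + b + i + j + 1, by omega, by omega, by omega, by omega⟩
  have hg := ha.mono (show a ≤ M + 1 by omega)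
  have hh := hb.mono (show b ≤ M + 1 by omega)
  have hi : i < M + 1 := by omega
  have hj : j < M + 1 := by omega
  set I : Fin (M + 1) := ⟨i, hi⟩
  set J : Fin (M + 1) := ⟨j, hj⟩
  have hIJ : I ≠ J := by simpa [I, J, Fin.ext_iff] using hij
  have hJl : J ≠ Fin.last M := by simp [J, Fin.ext_iff]; omega
  set G := corner (M + 1) (g : OneAddMInf R).val with hG
  set H := corner (M + 1) ((g⁻¹ : GLInf R) : OneAddMInf R).val with hH
  have HG : H * G = 1 := by
    rw [hG, hH, ← corner_mul hh, ← Units.val_mul, inv_mul_cancel, Units.val_one, val_one,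
      corner_one]
  obtain ⟨A, hAE, hAL, hAC⟩ := exists_column M
    (fun p => (g : OneAddMInf R).val p i) M le_rfl
  obtain ⟨B, hBE, hBL, hBC⟩ := exists_row M
    (fun p => r * ((g⁻¹ : GLInf R) : OneAddMInf R).val j p) M le_rfl
  have hAC' : corner (M + 1) (A : OneAddMInf R).val =
      1 + G * Matrix.single I (Fin.last M) 1 := by
    rw [hAC]
    congr 1
    ext p q
    rw [Matrix.sum_apply]
    rcases eq_or_ne q (Fin.last M) with rfl | hq
    · rw [Matrix.mul_single_apply_same, mul_one, Finset.sum_eq_single p]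
      · split_ifs with hp
        · simp [hG, corner, I]
        · have hp' : p.1 = M := by omega
          rw [Matrix.zero_apply, hG]
          change 0 = (g : OneAddMInf R).val p.1 i
          rw [ha _ _ (Or.inl (by omega)), Matrix.one_apply_ne (by omega)]
      · intro b _ hb
        split_ifs <;> simp [hb]
      · simp
    · rw [Matrix.mul_single_apply_of_ne _ _ _ _ _ hq]
      apply Finset.sum_eq_zero
      intro b _
      split_ifs <;> simp [hq.symm]
  have hBC' : corner (M + 1) (B : OneAddMInf R).val =
      1 + Matrix.single (Fin.last M) J r * H := by
    rw [hBC]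
    congr 1
    ext q p
    rw [Matrix.sum_apply]
    rcases eq_or_ne q (Fin.last M) with rfl | hq
    · rw [Matrix.single_mul_apply_same, Finset.sum_eq_single p]
      · split_ifs with hp
        · simp [hH, corner, J]
        · have hp' : p.1 = M := by omega
          rw [Matrix.zero_apply, hH]
          change 0 = r * ((g⁻¹ : GLInf R) : OneAddMInf R).val j p.1
          rw [hb _ _ (Or.inr (by omega)), Matrix.one_apply_ne (by omega), mul_zero]
      · intro b _ hb
        split_ifs <;> simp [hb]
      · simp
    · rw [Matrix.single_mul_apply_of_ne _ _ _ _ _ hq]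
      apply Finset.sum_eq_zero
      intro b _
      split_ifs <;> simp [hq.symm]
  have hHl : H J (Fin.last M) = 0 := by
    change ((g⁻¹ : GLInf R) : OneAddMInf R).val j M = 0
    rw [hb _ _ (Or.inr hbM), Matrix.one_apply_ne (by omega)]
  have hel : Level (M + 1) ((elementary i j hij r : GLInf R) : OneAddMInf R).val :=
    level_oneAddSingle hi hj r
  have main : (g * elementary i j hij r * g⁻¹) * (B * A) = A * B := by
    apply Units.ext
    apply OneAddMInf.ext
    have hX : Level (M + 1)
        ((g * elementary i j hij r * g⁻¹ : GLInf R) : OneAddMInf R).val :=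
      level_mul (level_mul hg hel) hh
    apply eq_of_corner (n := M + 1) (level_mul hX (level_mul hBL hAL)) (level_mul hAL hBL)
    rw [corner_mul hX, corner_mul hBL,
      corner_mul hAL, Units.val_mul, Units.val_mul,
      corner_mul (level_mul hg hel),
      corner_mul hg]
    change G * corner (M + 1) (oneAddSingle i j r).val * H * _ = _
    rw [corner_oneAddSingle hi hj, hAC', hBC']
    have GH : G * H = 1 := by
      rw [hG, hH, ← corner_mul hg, ← Units.val_mul, mul_inv_cancel, Units.val_one, val_one,
        corner_one]
    set α := G * Matrix.single I (Fin.last M) (1 : R) with hα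
    set β := Matrix.single (Fin.last M) J r * H with hβ
    have hαβ : G * (1 + Matrix.single I J r) * H = 1 + α * β := by
      have : α * β = G * Matrix.single I J r * H := by
        rw [hα, hβ, Matrix.mul_assoc G, ← Matrix.mul_assoc _ _ H,
          Matrix.single_mul_single_same, one_mul, ← Matrix.mul_assoc]
      rw [this, mul_add, add_mul, mul_one, GH]
    have hβα : β * α = 0 := by
      rw [hα, hβ, Matrix.mul_assoc, ← Matrix.mul_assoc H, HG, one_mul,
        Matrix.single_mul_single_of_ne _ _ _ _ hIJ.symm]
    have hββ : β * β = 0 := by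
      rw [hβ, ← Matrix.mul_assoc, Matrix.single_mul_mul_single, hHl]
      simp
    change G * (1 + Matrix.single I J r) * H * _ = _
    rw [hαβ]
    calc (1 + α * β) * ((1 + β) * (1 + α))
        = 1 + α + β + β * α + α * β + α * (β * α) + α * (β * β) + α * (β * (β * α)) := by
          noncomm_ring
      _ = (1 + α) * (1 + β) := by rw [hβα, hββ]; noncomm_ring
  have : g * elementary i j hij r * g⁻¹ = A * B * (B * A)⁻¹ := eq_mul_inv_of_mul_eq main
  rw [this]
  exact mul_mem (mul_mem hAE hBE) (inv_mem (mul_mem hBE hAE))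

/-- `E_∞(R)` is a normal subgroup of `GL_∞(R)`. -/
instance E_normal : (E R).Normal := by
  refine ⟨fun n hn g => ?_⟩
  have : E R ≤ (E R).comap (MulAut.conj g).toMonoidHom := by
    rw [E, Subgroup.closure_le]
    rintro _ ⟨i, j, h, r, rfl⟩
    exact conj_elementary_mem g i j h r
  exact this hn

end GLInf

/-- `K₁(R) = GL_∞(R) / E_∞(R)`. -/
abbrev K1 (R : Type*) [Ring R] : Type _ := GLInf R ⧸ GLInf.E R

/-- The homomorphism `K* → GL_∞(𝕊₁)`, `λ ↦ λ E₀₀ + 1 - E₀₀`. -/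
def muK (K : Type*) [Field K] : Kˣ →* GLInf (OneSidedInverseAlg K) :=
  GLInf.mu.comp (Units.map (algebraMap K (OneSidedInverseAlg K) : K →* OneSidedInverseAlg K))

/-- The subgroup `U(K) = {λ E₀₀ + 1 - E₀₀ | λ ∈ K*}` of `GL_∞(𝕊₁)`. -/
def UK (K : Type*) [Field K] : Subgroup (GLInf (OneSidedInverseAlg K)) := (muK K).range

end

/-! The idempotent `e = 1 - x y` generates an ideal `I` of `𝕊₁` spanned by the matrix units `x^a e
y^b`. Thus `I ≅ M_∞(K)`, while `𝕊₁ / I ≅ K[x, x⁻¹]`. The group `GL_∞(𝕊₁)` is controlled by comparing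
these two pieces.

Over the quotient, Euclidean row reduction makes every invertible matrix equal to `μ(u)` modulo
`E_∞`, with `u = a x^n` (`exists_mk_eq_mk_mu`, `exists_eq_algebraMap_mul_unitT`). Elementary
matrices lift along the surjection, so any `g` becomes, up to `muK a` and `E_∞(𝕊₁)`, a matrix lying
over `μ(x^n)`.

Two facts about the kernel finish existence. Matrices in `1 + M_∞(I)` are, blockwise, finite
matrices over `K`, so one-sided inverses among them are two-sided; this forces `n = 0`, because `y^k
x^k = 1` while `x^k y^k ≠ 1` for `k > 0` (`eq_zero_of_map_val_eq`). Moreover, every invertible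
matrix over the identity lies in `E_∞(𝕊₁)` (`mem_E_of_map_eq_one`): over `K` it is a product of
transvections and diagonal matrices, and the diagonal factors are elementary because `1 + (c - 1) e
E₀₀` is a commutator of `μ(c)` with the elementary matrix `[[x, x y - 1], [0, y]]`
(`exists_oneAddSingle_mem_E`).

Uniqueness comes from the character `x, y ↦ 1` to `K` followed by the determinant
(`eq_one_of_muK_mem_E`). -/

noncomputable section

/-! ### Functoriality, finite corners, and row and column operations -/

namespace OneAddMInf

variable {R S : Type*} [Ring R] [Ring S]

theorem level_map (f : R →+* S) {n : ℕ} {A : Matrix ℕ ℕ R} (h : Level n A) :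
    Level n (A.map f) := fun i j hij => by
  rw [Matrix.map_apply, h i j hij, Matrix.one_apply, Matrix.one_apply]
  split_ifs <;> simp

theorem corner_map (f : R →+* S) (n : ℕ) (A : Matrix ℕ ℕ R) :
    corner n (A.map f) = (corner n A).map f := rfl

/-- The monoid homomorphism `1 + M_∞(R) → 1 + M_∞(S)` induced by a ring homomorphism. -/
def map (f : R →+* S) : OneAddMInf R →* OneAddMInf S where
  toFun A := ⟨A.val.map f, A.exists_level.imp fun _ h => level_map f h⟩
  map_one' := by
    apply OneAddMInf.ext
    change (1 : Matrix ℕ ℕ R).map f = 1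
    simp
  map_mul' A B := by
    obtain ⟨a, ha⟩ := A.exists_level
    obtain ⟨b, hb⟩ := B.exists_level
    have ha' := ha.mono (le_max_left a b)
    have hb' := hb.mono (le_max_right a b)
    apply OneAddMInf.ext
    apply eq_of_corner (level_map f (level_mul ha' hb'))
      (mulVal_level (level_map f ha') (level_map f hb'))
    rw [corner_map, corner_mul ha', corner_mulVal (level_map f ha'), Matrix.map_mul]
    rfl

theorem map_val (f : R →+* S) (A : OneAddMInf R) : (map f A).val = A.val.map f := rfl

theorem map_oneAddSingle (f : R →+* S) (i j : ℕ) (r : R) :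
    map f (oneAddSingle i j r) = oneAddSingle i j (f r) := by
  apply OneAddMInf.ext
  ext p q
  simp only [map_val, oneAddSingle, Matrix.map_apply, Matrix.add_apply, Matrix.one_apply,
    Matrix.single_apply]
  split_ifs <;> simp

/-- The extension of an `n × n` matrix by the identity matrix. -/
def extend (n : ℕ) (A : Matrix (Fin n) (Fin n) R) : Matrix ℕ ℕ R := Matrix.of fun i j =>
  if h : i < n ∧ j < n then A ⟨i, h.1⟩ ⟨j, h.2⟩ else (1 : Matrix ℕ ℕ R) i j

theorem level_extend (n : ℕ) (A : Matrix (Fin n) (Fin n) R) : Level n (extend n A) :=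
  fun _ _ h => dif_neg (by omega)

theorem corner_extend (n : ℕ) (A : Matrix (Fin n) (Fin n) R) : corner n (extend n A) = A := by
  ext i j
  simp [corner, extend]

/-- The extension of `n × n` matrices by the identity matrix, as a monoid homomorphism. -/
def ofMatrix (R : Type*) [Ring R] (n : ℕ) : Matrix (Fin n) (Fin n) R →* OneAddMInf R where
  toFun A := ⟨extend n A, n, level_extend n A⟩
  map_one' := OneAddMInf.ext <| eq_of_corner (level_extend n 1) (level_one n) <| by
    rw [corner_extend, val_one, corner_one]
  map_mul' A B := OneAddMInf.ext <|
    eq_of_corner (level_extend n _) (mulVal_level (level_extend n A) (level_extend n B)) <|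
      ((corner_mulVal (level_extend n A) (extend n B)).trans (by
        rw [corner_extend, corner_extend, corner_extend])).symm

theorem level_ofMatrix (n : ℕ) (A : Matrix (Fin n) (Fin n) R) : Level n (ofMatrix R n A).val :=
  level_extend n A

theorem corner_ofMatrix (n : ℕ) (A : Matrix (Fin n) (Fin n) R) :
    corner n (ofMatrix R n A).val = A :=
  corner_extend n A

theorem ofMatrix_corner {n : ℕ} {A : OneAddMInf R} (h : Level n A.val) :
    ofMatrix R n (corner n A.val) = A :=
  OneAddMInf.ext (eq_of_corner (level_ofMatrix n _) h (corner_ofMatrix n _))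

theorem ofMatrix_injective (n : ℕ) : Function.Injective (ofMatrix R n) := fun A B h => by
  rw [← corner_ofMatrix n A, h, corner_ofMatrix]

theorem ofMatrix_one_add_single {n : ℕ} (i j : Fin n) (r : R) :
    ofMatrix R n (1 + Matrix.single i j r) = oneAddSingle (i : ℕ) j r := by
  rw [← ofMatrix_corner (level_oneAddSingle i.2 j.2 r), corner_oneAddSingle i.2 j.2]

theorem oneAddSingle_injective (i j : ℕ) : Function.Injective (oneAddSingle i j : R → _) := by
  intro r s h
  have := congrFun (congrFun (congrArg OneAddMInf.val h) i) j
  simpa [oneAddSingle] using this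

/-- Left multiplication by `1 + r E_{ij}` adds `r` times row `j` to row `i`. -/
theorem oneAddSingle_mul_val (i j : ℕ) (r : R) (A : OneAddMInf R) (p q : ℕ) :
    (oneAddSingle i j r * A).val p q = A.val p q + if p = i then r * A.val j q else 0 := by
  obtain ⟨a, ha⟩ := A.exists_level
  obtain ⟨n, hn⟩ : ∃ n, n = a + i + j + p + q + 1 := ⟨_, rfl⟩
  have hi : i < n := by omega
  have hj : j < n := by omega
  have hp : p < n := by omega
  have hq : q < n := by omega
  have h := congrFun (congrFun (corner_mul (B := A) (level_oneAddSingle hi hj r)) ⟨p, hp⟩) ⟨q, hq⟩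
  rw [corner_oneAddSingle hi hj, add_mul, one_mul, Matrix.add_apply] at h
  refine h.trans ?_
  congr 1
  split_ifs with hpi
  · subst hpi
    rw [Matrix.single_mul_apply_same]; rfl
  · rw [Matrix.single_mul_apply_of_ne]
    simpa [Fin.ext_iff] using hpi

/-- Right multiplication by `1 + r E_{ij}` adds column `i` times `r` to column `j`. -/
theorem mul_oneAddSingle_val (i j : ℕ) (r : R) (A : OneAddMInf R) (p q : ℕ) :
    (A * oneAddSingle i j r).val p q = A.val p q + if q = j then A.val p i * r else 0 := by
  obtain ⟨a, ha⟩ := A.exists_level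
  obtain ⟨n, hn⟩ : ∃ n, n = a + i + j + p + q + 1 := ⟨_, rfl⟩
  have hi : i < n := by omega
  have hj : j < n := by omega
  have hp : p < n := by omega
  have hq : q < n := by omega
  have h := congrFun (congrFun (corner_mul (B := oneAddSingle i j r)
    (ha.mono (show a ≤ n by omega))) ⟨p, hp⟩) ⟨q, hq⟩
  rw [corner_oneAddSingle hi hj, mul_add, mul_one, Matrix.add_apply] at h
  refine h.trans ?_
  congr 1
  split_ifs with hpi
  · subst hpi
    rw [Matrix.mul_single_apply_same]; rfl
  · rw [Matrix.mul_single_apply_of_ne]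
    simpa [Fin.ext_iff] using hpi

end OneAddMInf

/-! ### Lifting elementary matrices, and the determinant on `E_∞` -/

namespace GLInf

open OneAddMInf

variable {R S : Type*} [Ring R] [Ring S]

/-- The group homomorphism `GL_∞(R) → GL_∞(S)` induced by a ring homomorphism. -/
def map (f : R →+* S) : GLInf R →* GLInf S := Units.map (OneAddMInf.map f)

theorem coe_map (f : R →+* S) (g : GLInf R) :
    (map f g : OneAddMInf S) = OneAddMInf.map f (g : OneAddMInf R) := rfl

theorem map_elementary (f : R →+* S) (i j : ℕ) (h : i ≠ j) (r : R) :
    map f (elementary i j h r) = elementary i j h (f r) :=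
  Units.ext (map_oneAddSingle f i j r)

theorem coe_mu (u : Rˣ) : (mu u : OneAddMInf R) = oneAddSingle 0 0 ((u : R) - 1) := rfl

theorem map_mem_E (f : R →+* S) {g : GLInf R} (hg : g ∈ E R) : map f g ∈ E S := by
  have : E R ≤ (E S).comap (map f) := by
    rw [E, Subgroup.closure_le]
    rintro _ ⟨i, j, h, r, rfl⟩
    change map f _ ∈ E S
    rw [map_elementary]
    exact elementary_mem _ _ _ _
  exact this hg

theorem exists_mem_E_map_eq {f : R →+* S} (hf : Function.Surjective f) {g : GLInf S}
    (hg : g ∈ E S) : ∃ e ∈ E R, map f e = g := by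
  have : E S ≤ (E R).map (map f) := by
    rw [E, Subgroup.closure_le]
    rintro _ ⟨i, j, h, r, rfl⟩
    obtain ⟨s, rfl⟩ := hf r
    exact ⟨_, elementary_mem i j h s, map_elementary f i j h s⟩
  exact this hg

/-- The corner determinant is multiplicative only on corners large enough to contain the factors, so
the claim is made for all large `n`; this form passes through products and inverses. -/
theorem det_corner_of_mem_E {R : Type*} [CommRing R] {g : GLInf R} (hg : g ∈ E R) :
    ∃ m, ∀ n ≥ m, (corner n (g : OneAddMInf R).val).det = 1 := by
  induction hg using Subgroup.closure_induction with
  | mem g hg =>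
    obtain ⟨i, j, h, r, rfl⟩ := hg
    refine ⟨i + j + 1, fun n hn => ?_⟩
    change (corner n (oneAddSingle i j r).val).det = 1
    rw [corner_oneAddSingle (by omega : i < n) (by omega : j < n)]
    exact Matrix.det_transvection_of_ne _ _ (by simpa [Fin.ext_iff] using h) r
  | one => exact ⟨0, fun n _ => by rw [Units.val_one, val_one, corner_one, Matrix.det_one]⟩
  | mul g h _ _ ihg ihh =>
    obtain ⟨a, ha⟩ := ihg
    obtain ⟨b, hb⟩ := ihh
    obtain ⟨c, hc⟩ := (g : OneAddMInf R).exists_level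
    refine ⟨a + b + c, fun n hn => ?_⟩
    rw [Units.val_mul, corner_mul (hc.mono (by omega)), Matrix.det_mul, ha n (by omega),
      hb n (by omega), one_mul]
  | inv g _ ihg =>
    obtain ⟨a, ha⟩ := ihg
    obtain ⟨c, hc⟩ := (g : OneAddMInf R).exists_level
    refine ⟨a + c, fun n hn => ?_⟩
    have h : corner n ((g * g⁻¹ : GLInf R) : OneAddMInf R).val = 1 := by
      rw [mul_inv_cancel, Units.val_one, val_one, corner_one]
    rw [Units.val_mul, corner_mul (hc.mono (by omega))] at h
    have h2 := congrArg Matrix.det h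
    rwa [Matrix.det_mul, ha n (by omega), one_mul, Matrix.det_one] at h2

theorem eq_one_of_mu_mem_E {R : Type*} [CommRing R] {u : Rˣ} (hu : mu u ∈ E R) : u = 1 := by
  obtain ⟨m, hm⟩ := det_corner_of_mem_E hu
  have h := hm (m + 1) (by omega)
  rw [coe_mu, corner_oneAddSingle (Nat.succ_pos m) (Nat.succ_pos m)] at h
  have hd : (1 + Matrix.single (⟨0, Nat.succ_pos m⟩ : Fin (m + 1)) ⟨0, Nat.succ_pos m⟩
      ((u : R) - 1)) = Matrix.diagonal (Function.update 1 ⟨0, Nat.succ_pos m⟩ (u : R)) := by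
    rw [← Matrix.diagonal_one, ← Matrix.diagonal_single, Matrix.diagonal_add]
    congr 1
    ext p
    by_cases hp : p = ⟨0, Nat.succ_pos m⟩
    · subst hp; simp
    · simp [show p ≠ 0 from hp]
  rw [hd, Matrix.det_diagonal, Finset.prod_update_of_mem (Finset.mem_univ _)] at h
  apply Units.ext
  simpa using h

end GLInf

/-! ### Euclidean reduction of pairs -/

/-- Every pair of elements can be brought to the form `(0, d)` by elementary operations. -/
def HasPairReduction (R : Type*) [CommRing R] : Prop :=
  ∀ M : R → R → Prop, (∀ b, M 0 b) → (∀ a b r, M (a + r * b) b → M a b) →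
    (∀ a b r, M a (b + r * a) → M a b) → ∀ a b, M a b

theorem HasPairReduction.of_euclideanDomain (R : Type*) [EuclideanDomain R] :
    HasPairReduction R := by
  classical
  intro M h0 h1 h2 a b
  -- A Euclidean step exchanges the roles of the two entries, so the induction needs both orders.
  suffices h : M a b ∧ M b a from h.1
  induction a, b using EuclideanDomain.GCD.induction with
  | H0 x => exact ⟨h0 x, h2 x 0 1 (h1 x _ (-1) (by simpa using h0 x))⟩
  | H1 a b _ ih =>
    have h : b + -(b / a) * a = b % a := by
      rw [EuclideanDomain.mod_eq_sub_mul_div]; ring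
    exact ⟨h2 a b (-(b / a)) (h ▸ ih.2), h1 b a (-(b / a)) (h ▸ ih.1)⟩

open LaurentPolynomial Polynomial in
-- Pair reduction is homogeneous: a pair over `K[X]` scaled by a common `T n` reduces by the same
-- operations, and any two Laurent polynomials have a common denominator.
theorem LaurentPolynomial.hasPairReduction (K : Type*) [Field K] : HasPairReduction K[T;T⁻¹] := by
  intro M h0 h1 h2 a b
  have key : ∀ (n : ℤ) (p q : K[X]), M (toLaurent p * T n) (toLaurent q * T n) := fun n =>
    HasPairReduction.of_euclideanDomain K[X] (fun p q => M (toLaurent p * T n) (toLaurent q * T n))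
      (fun q => by simpa using h0 _)
      (fun p q r h => h1 _ _ (toLaurent r) (by
        rwa [map_add, map_mul, add_mul, mul_assoc] at h))
      (fun p q r h => h2 _ _ (toLaurent r) (by
        rwa [map_add, map_mul, add_mul, mul_assoc] at h))
  obtain ⟨n, p, hp⟩ := exists_T_pow a
  obtain ⟨m, q, hq⟩ := exists_T_pow b
  have h := key (-(n + m : ℤ)) (p * X ^ m) (q * X ^ n)
  have e1 : toLaurent (p * X ^ m) * T (-(n + m : ℤ)) = a := by
    rw [map_mul, hp, Polynomial.toLaurent_X_pow, mul_assoc, mul_assoc, ← T_add, ← T_add,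
      show (n + (m + -(n + m)) : ℤ) = 0 by ring, T_zero, mul_one]
  have e2 : toLaurent (q * X ^ n) * T (-(n + m : ℤ)) = b := by
    rw [map_mul, hq, Polynomial.toLaurent_X_pow, mul_assoc, mul_assoc, ← T_add, ← T_add,
      show (m + (n + -(n + m)) : ℤ) = 0 by ring, T_zero, mul_one]
  rwa [e1, e2] at h

/-! ### Reduction of invertible matrices to a single unit -/

namespace GLInf

open OneAddMInf

section Ring

variable {R : Type*} [Ring R]

theorem coe_elementary (i j : ℕ) (h : i ≠ j) (r : R) :
    (elementary i j h r : OneAddMInf R) = oneAddSingle i j r := rfl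

theorem mk_mul_left {e : GLInf R} (he : e ∈ E R) (g : GLInf R) :
    (QuotientGroup.mk (e * g) : K1 R) = QuotientGroup.mk g := by
  rw [QuotientGroup.mk_mul, (QuotientGroup.eq_one_iff e).2 he, one_mul]

theorem mk_mul_right {e : GLInf R} (he : e ∈ E R) (g : GLInf R) :
    (QuotientGroup.mk (g * e) : K1 R) = QuotientGroup.mk g := by
  rw [QuotientGroup.mk_mul, (QuotientGroup.eq_one_iff e).2 he, mul_one]

theorem level_elementary_mul {n i j : ℕ} (hi : i < n) (hj : j < n) (h : i ≠ j) (r : R)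
    {g : GLInf R} (hg : Level n (g : OneAddMInf R).val) :
    Level n ((elementary i j h r * g : GLInf R) : OneAddMInf R).val :=
  level_mul (level_oneAddSingle hi hj r) hg

theorem level_mul_elementary {n i j : ℕ} (hi : i < n) (hj : j < n) (h : i ≠ j) (r : R)
    {g : GLInf R} (hg : Level n (g : OneAddMInf R).val) :
    Level n ((g * elementary i j h r : GLInf R) : OneAddMInf R).val :=
  level_mul hg (level_oneAddSingle hi hj r)

/-- Clearing the last row by column operations. -/
theorem exists_clear_row {n : ℕ} (g : GLInf R) (hg : Level (n + 1) (g : OneAddMInf R).val)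
    (hcol : ∀ p, (g : OneAddMInf R).val p n = (1 : Matrix ℕ ℕ R) p n) (m : ℕ) (hm : m ≤ n) :
    ∃ e ∈ E R, Level (n + 1) ((g * e : GLInf R) : OneAddMInf R).val ∧
      (∀ p, ((g * e : GLInf R) : OneAddMInf R).val p n = (1 : Matrix ℕ ℕ R) p n) ∧
      ∀ q < m, ((g * e : GLInf R) : OneAddMInf R).val n q = 0 := by
  induction m with
  | zero => exact ⟨1, one_mem _, by rwa [mul_one], by rwa [mul_one], by simp⟩
  | succ m ih =>
    obtain ⟨e, he, hl, hc, hr⟩ := ih (by omega)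
    set g' := g * e with hg'
    refine ⟨e * elementary n m (by omega) (-(g' : OneAddMInf R).val n m),
      mul_mem he (elementary_mem _ _ _ _), ?_⟩
    rw [← mul_assoc, ← hg']
    refine ⟨level_mul_elementary (by omega) (by omega) _ _ hl, fun p => ?_, fun q hq => ?_⟩
    · rw [Units.val_mul, coe_elementary, mul_oneAddSingle_val, if_neg (by omega), add_zero, hc]
    · rw [Units.val_mul, coe_elementary, mul_oneAddSingle_val, hc]
      split_ifs with h
      · simp [h]
      · rw [add_zero, hr q (by omega)]

end Ring

variable {R : Type*} [CommRing R]

/-- The predicate fed to `HasPairReduction` quantifies over all matrices whose entries at `(i, k)`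
and `(j, k)` are the given pair, so each reduction of the pair is realised by a row operation. -/
theorem exists_clear_entry (hR : HasPairReduction R) {i j : ℕ} (hij : i ≠ j) (k : ℕ)
    (g : GLInf R) : ∃ e ∈ E R, ((e * g : GLInf R) : OneAddMInf R).val i k = 0 ∧
      (∀ p q, p ≠ i → p ≠ j →
        ((e * g : GLInf R) : OneAddMInf R).val p q = (g : OneAddMInf R).val p q) ∧
      ∀ n, i < n → j < n → Level n (g : OneAddMInf R).val →
        Level n ((e * g : GLInf R) : OneAddMInf R).val := by
  refine hR (fun a b => ∀ g : GLInf R, (g : OneAddMInf R).val i k = a →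
    (g : OneAddMInf R).val j k = b → ∃ e ∈ E R, ((e * g : GLInf R) : OneAddMInf R).val i k = 0 ∧
      (∀ p q, p ≠ i → p ≠ j →
        ((e * g : GLInf R) : OneAddMInf R).val p q = (g : OneAddMInf R).val p q) ∧
      ∀ n, i < n → j < n → Level n (g : OneAddMInf R).val →
        Level n ((e * g : GLInf R) : OneAddMInf R).val) ?_ ?_ ?_ _ _ g rfl rfl
  · exact fun b g ha _ => ⟨1, one_mem _, by rwa [one_mul], by simp, by simp⟩
  · intro a b r ih g ha hb
    obtain ⟨e, he, h1, h2, h3⟩ := ih (elementary i j hij r * g)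
      (by rw [Units.val_mul, coe_elementary, oneAddSingle_mul_val, if_pos rfl, ha, hb])
      (by rw [Units.val_mul, coe_elementary, oneAddSingle_mul_val, if_neg hij.symm, add_zero, hb])
    refine ⟨e * elementary i j hij r, mul_mem he (elementary_mem _ _ _ _), ?_⟩
    rw [mul_assoc]
    refine ⟨h1, fun p q hp hq => ?_, fun n hi hj hl => h3 n hi hj ?_⟩
    · rw [h2 p q hp hq, Units.val_mul, coe_elementary, oneAddSingle_mul_val, if_neg hp, add_zero]
    · exact level_elementary_mul hi hj hij r hl
  · intro a b r ih g ha hb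
    obtain ⟨e, he, h1, h2, h3⟩ := ih (elementary j i hij.symm r * g)
      (by rw [Units.val_mul, coe_elementary, oneAddSingle_mul_val, if_neg hij, add_zero, ha])
      (by rw [Units.val_mul, coe_elementary, oneAddSingle_mul_val, if_pos rfl, ha, hb])
    refine ⟨e * elementary j i hij.symm r, mul_mem he (elementary_mem _ _ _ _), ?_⟩
    rw [mul_assoc]
    refine ⟨h1, fun p q hp hq => ?_, fun n hi hj hl => h3 n hi hj ?_⟩
    · rw [h2 p q hp hq, Units.val_mul, coe_elementary, oneAddSingle_mul_val, if_neg hq, add_zero]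
    · exact level_elementary_mul hj hi hij.symm r hl

/-- Clearing the last column, above the diagonal, by row operations. -/
theorem exists_clear_column (hR : HasPairReduction R) {n : ℕ} (g : GLInf R)
    (hg : Level (n + 1) (g : OneAddMInf R).val) (m : ℕ) (hm : m ≤ n) :
    ∃ e ∈ E R, Level (n + 1) ((e * g : GLInf R) : OneAddMInf R).val ∧
      ∀ p < m, ((e * g : GLInf R) : OneAddMInf R).val p n = 0 := by
  induction m with
  | zero => exact ⟨1, one_mem _, by rwa [one_mul], by simp⟩
  | succ m ih =>
    obtain ⟨e, he, hl, hr⟩ := ih (by omega)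
    obtain ⟨e', he', h1, h2, h3⟩ := exists_clear_entry hR (show m ≠ n by omega) n (e * g)
    refine ⟨e' * e, mul_mem he' he, ?_⟩
    rw [mul_assoc]
    refine ⟨h3 _ (by omega) (by omega) hl, fun p hp => ?_⟩
    rcases eq_or_ne p m with rfl | hpm
    · exact h1
    · rw [h2 p n hpm (by omega), hr p (by omega)]

/-- In the entry `(n, n)` of `g⁻¹ g = 1` only one term survives, which gives the pivot a left
inverse. -/
theorem isUnit_of_column {n : ℕ} {g : GLInf R} (hg : Level (n + 1) (g : OneAddMInf R).val)
    (hc : ∀ p < n, (g : OneAddMInf R).val p n = 0) : IsUnit ((g : OneAddMInf R).val n n) := by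
  obtain ⟨a, ha⟩ := ((g⁻¹ : GLInf R) : OneAddMInf R).exists_level
  have hN := ha.mono (show a ≤ a + n + 1 by omega)
  have h : mulVal ((g⁻¹ : GLInf R) : OneAddMInf R).val (g : OneAddMInf R).val n n = 1 := by
    rw [← val_mul, ← Units.val_mul, inv_mul_cancel, Units.val_one, val_one, Matrix.one_apply_eq]
  rw [mulVal_eq_sum hN _ (by omega), Finset.sum_eq_single n] at h
  · exact IsUnit.of_mul_eq_one_right _ h
  · intro j _ hj
    rcases lt_or_gt_of_ne hj with hj | hj
    · rw [hc j hj, mul_zero]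
    · rw [hg j n (Or.inl hj), Matrix.one_apply_ne (by omega), mul_zero]
  · intro h; exact absurd (Finset.mem_range.2 (by omega)) h

/-- If pairs over `R` can be reduced, every class in `K₁(R)` is represented by a unit. -/
theorem exists_mk_eq_mk_mu (hR : HasPairReduction R) (g : GLInf R) :
    ∃ u : Rˣ, (QuotientGroup.mk g : K1 R) = QuotientGroup.mk (mu u) := by
  obtain ⟨n, hn⟩ := (g : OneAddMInf R).exists_level
  -- Raising the level by one makes the `1 × 1` corner, rather than the empty one, the base case.
  replace hn := hn.mono n.le_succ
  induction n generalizing g with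
  | zero =>
    obtain ⟨u, hu⟩ := isUnit_of_column hn (by simp)
    refine ⟨u, congrArg _ ?_⟩
    apply Units.ext
    apply OneAddMInf.ext
    refine eq_of_corner (n := 1) hn (level_oneAddSingle one_pos one_pos _) ?_
    rw [coe_mu, corner_oneAddSingle one_pos one_pos, hu]
    ext i j
    have hi : i = 0 := Subsingleton.elim _ _
    have hj : j = 0 := Subsingleton.elim _ _
    subst hi hj
    simp [corner]
  | succ n ih =>
    obtain ⟨e, he, hl, hc⟩ := exists_clear_column hR g hn (n + 1) le_rfl
    obtain ⟨d, hd⟩ := isUnit_of_column hl hc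
    rw [← mk_mul_left he]
    set g₁ := e * g
    have hne : (0 : ℕ) ≠ n + 1 := by omega
    -- On rows `0` and `n + 1` the last column goes `(0, d) → (1, d) → (1, 1) → (0, 1)`, which
    -- normalises the pivot.
    set e₁ : GLInf R := elementary 0 (n + 1) hne (-1) * (elementary (n + 1) 0 hne.symm (1 - (d : R)) *
      elementary 0 (n + 1) hne (↑d⁻¹ : R)) with he₁
    have he₁E : e₁ ∈ E R :=
      mul_mem (elementary_mem _ _ _ _) (mul_mem (elementary_mem _ _ _ _) (elementary_mem _ _ _ _))
    rw [← mk_mul_left he₁E]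
    have hl₁ : Level (n + 1 + 1) ((e₁ * g₁ : GLInf R) : OneAddMInf R).val := by
      rw [he₁, mul_assoc, mul_assoc]
      exact level_elementary_mul (by omega) (by omega) _ _ (level_elementary_mul (by omega)
        (by omega) _ _ (level_elementary_mul (by omega) (by omega) _ _ hl))
    have hc₁ : ∀ p, ((e₁ * g₁ : GLInf R) : OneAddMInf R).val p (n + 1) =
        (1 : Matrix ℕ ℕ R) p (n + 1) := by
      intro p
      rw [he₁, mul_assoc, mul_assoc]
      simp only [Units.val_mul, coe_elementary, oneAddSingle_mul_val]
      rw [← hd, hc 0 (by omega)]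
      rcases lt_trichotomy p (n + 1) with hp | rfl | hp
      · rw [hc p hp, Matrix.one_apply_ne hp.ne]
        rcases eq_or_ne p 0 with rfl | hp0
        · simp
        · simp [hp0, hp.ne]
      · rw [← hd]
        simp
      · rw [hl p (n + 1) (Or.inl (by omega)), Matrix.one_apply_ne hp.ne']
        simp [hp.ne', show p ≠ 0 by omega]
    obtain ⟨e₂, he₂, hl₂, hc₂, hr₂⟩ := exists_clear_row _ hl₁ hc₁ (n + 1) le_rfl
    rw [← mk_mul_right he₂]
    -- The last row and column are now those of the identity, so the level drops by one.
    refine ih _ fun p q hpq => ?_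
    by_cases h : n + 1 + 1 ≤ p ∨ n + 1 + 1 ≤ q
    · exact hl₂ p q h
    rcases eq_or_ne q (n + 1) with rfl | hq
    · exact hc₂ p
    · obtain rfl : p = n + 1 := by omega
      rw [hr₂ q (by omega), Matrix.one_apply_ne (by omega)]

end GLInf

/-! ### Matrix units in `𝕊₁` -/

namespace OneSidedInverseAlg

variable (K : Type*) [Field K]

/-- The generator `x`. -/
def x : OneSidedInverseAlg K := RingQuot.mkAlgHom K (OneSidedInverseRel K) (FreeAlgebra.ι K false)

/-- The generator `y`. -/
def y : OneSidedInverseAlg K := RingQuot.mkAlgHom K (OneSidedInverseRel K) (FreeAlgebra.ι K true)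

/-- The idempotent `1 - x y`. -/
def e : OneSidedInverseAlg K := 1 - x K * y K

theorem y_mul_x : y K * x K = 1 := by
  rw [x, y, ← map_mul, RingQuot.mkAlgHom_rel K (OneSidedInverseRel.yx (K := K)), map_one]

variable {K} in
/-- The universal property of `𝕊₁`. -/
def lift {A : Type*} [Ring A] [Algebra K A] (a b : A) (h : b * a = 1) :
    OneSidedInverseAlg K →ₐ[K] A :=
  RingQuot.liftAlgHom K ⟨FreeAlgebra.lift K fun t => if t then b else a, by
    rintro _ _ ⟨⟩
    simpa using h⟩

variable {K} in
theorem lift_x {A : Type*} [Ring A] [Algebra K A] (a b : A) (h : b * a = 1) :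
    lift (K := K) a b h (x K) = a := by
  simp [lift, x]

variable {K} in
theorem lift_y {A : Type*} [Ring A] [Algebra K A] (a b : A) (h : b * a = 1) :
    lift (K := K) a b h (y K) = b := by
  simp [lift, y]

variable {K} in
theorem induction {M : OneSidedInverseAlg K → Prop} (hc : ∀ c, M (algebraMap K _ c))
    (hx : M (x K)) (hy : M (y K)) (hadd : ∀ a b, M a → M b → M (a + b))
    (hmul : ∀ a b, M a → M b → M (a * b)) (s : OneSidedInverseAlg K) : M s := by
  obtain ⟨f, rfl⟩ := RingQuot.mkAlgHom_surjective K (OneSidedInverseRel K) s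
  induction f using FreeAlgebra.induction with
  | grade0 c => rw [AlgHom.commutes]; exact hc c
  | grade1 b => cases b with
    | false => exact hx
    | true => exact hy
  | mul a b iha ihb => rw [map_mul]; exact hmul _ _ iha ihb
  | add a b iha ihb => rw [map_add]; exact hadd _ _ iha ihb

theorem y_mul_e : y K * e K = 0 := by
  rw [e, mul_sub, ← mul_assoc, y_mul_x, mul_one, one_mul, sub_self]

theorem e_mul_x : e K * x K = 0 := by
  rw [e, sub_mul, mul_assoc, y_mul_x, mul_one, one_mul, sub_self]

theorem e_mul_e : e K * e K = e K := by
  nth_rw 2 [e]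
  rw [mul_sub, mul_one, ← mul_assoc, e_mul_x, zero_mul, sub_zero]

/-- In the representation by shifts on sequences, `1 - x y` is the projection to the zeroth term. -/
theorem e_ne_zero : e K ≠ 0 := by
  intro h
  let X : Module.End K (ℕ → K) :=
    { toFun := fun f n => Nat.casesOn n 0 f
      map_add' := fun f g => by ext n; cases n <;> simp
      map_smul' := fun c f => by ext n; cases n <;> simp }
  let Y : Module.End K (ℕ → K) :=
    { toFun := fun f n => f (n + 1)
      map_add' := fun f g => rfl
      map_smul' := fun c f => rfl }
  have hYX : Y * X = 1 := by ext f n; rfl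
  have h1 := congrArg (lift X Y hYX) h
  rw [e, map_sub, map_mul, lift_x, lift_y, map_one, map_zero] at h1
  have h2 := congrFun (LinearMap.congr_fun h1 (fun _ => (1 : K))) 0
  simp [X] at h2

theorem y_pow_mul_x_pow (n : ℕ) : y K ^ n * x K ^ n = 1 := by
  induction n with
  | zero => simp
  | succ n ih =>
    rw [pow_succ, pow_succ', mul_assoc, ← mul_assoc (y K), y_mul_x, one_mul, ih]

/-- The inner powers cancel by `y x = 1`; a surplus `x` is killed by `e x = 0` and a surplus `y` by
`y e = 0`. This is the source of the matrix unit relations. -/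
theorem e_mul_y_pow_mul_x_pow_mul_e (a b : ℕ) :
    e K * y K ^ a * (x K ^ b * e K) = if a = b then e K else 0 := by
  rcases lt_trichotomy a b with h | rfl | h
  · obtain ⟨c, rfl⟩ := Nat.exists_eq_add_of_lt h
    rw [if_neg (by omega), add_assoc, pow_add, mul_assoc (e K), mul_assoc (x K ^ a),
      ← mul_assoc (y K ^ a), y_pow_mul_x_pow, one_mul, pow_succ', ← mul_assoc, ← mul_assoc,
      e_mul_x, zero_mul, zero_mul]
  · rw [if_pos rfl, mul_assoc, ← mul_assoc (y K ^ a), y_pow_mul_x_pow, one_mul, e_mul_e]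
  · obtain ⟨c, rfl⟩ := Nat.exists_eq_add_of_lt h
    rw [if_neg (by omega), show b + c + 1 = (c + 1) + b by omega, pow_add, mul_assoc (e K),
      mul_assoc (y K ^ (c + 1)), ← mul_assoc (y K ^ b), y_pow_mul_x_pow, one_mul, pow_succ,
      mul_assoc (y K ^ c), y_mul_e, mul_zero, mul_zero]

/-- The matrix unit `x^a (1 - x y) y^b`. -/
def unit (a b : ℕ) : OneSidedInverseAlg K := x K ^ a * e K * y K ^ b

theorem x_mul_unit (a b : ℕ) : x K * unit K a b = unit K (a + 1) b := by
  simp only [unit, pow_succ', mul_assoc]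

theorem y_mul_unit_zero (b : ℕ) : y K * unit K 0 b = 0 := by
  rw [unit, pow_zero, one_mul, ← mul_assoc, y_mul_e, zero_mul]

theorem y_mul_unit_succ (a b : ℕ) : y K * unit K (a + 1) b = unit K a b := by
  rw [← x_mul_unit, ← mul_assoc, y_mul_x, one_mul]

/-- The span of the matrix units. -/
def unitSpan : Submodule K (OneSidedInverseAlg K) :=
  Submodule.span K (Set.range fun p : ℕ × ℕ => unit K p.1 p.2)

theorem unit_mem (a b : ℕ) : unit K a b ∈ unitSpan K := Submodule.subset_span ⟨(a, b), rfl⟩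

variable {K} in
theorem mul_mem_unitSpan (s : OneSidedInverseAlg K) :
    ∀ t ∈ unitSpan K, s * t ∈ unitSpan K := by
  induction s using induction with
  | hc c => intro t ht; rw [← Algebra.smul_def]; exact Submodule.smul_mem _ _ ht
  | hx =>
    intro t ht
    refine (Submodule.span_le (p := (unitSpan K).comap (LinearMap.mulLeft K (x K)))).2 ?_ ht
    rintro _ ⟨p, rfl⟩
    change x K * unit K p.1 p.2 ∈ unitSpan K
    rw [x_mul_unit]
    exact unit_mem K _ _
  | hy =>
    intro t ht
    refine (Submodule.span_le (p := (unitSpan K).comap (LinearMap.mulLeft K (y K)))).2 ?_ ht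
    rintro _ ⟨⟨a, b⟩, rfl⟩
    change y K * unit K a b ∈ unitSpan K
    cases a with
    | zero => rw [y_mul_unit_zero]; exact zero_mem _
    | succ a => rw [y_mul_unit_succ]; exact unit_mem K _ _
  | hadd a b iha ihb => intro t ht; rw [add_mul]; exact add_mem (iha t ht) (ihb t ht)
  | hmul a b iha ihb => intro t ht; rw [mul_assoc]; exact iha _ (ihb t ht)

/-- The difference telescopes into the diagonal units `x^i e y^i` with `i < k`. -/
theorem one_sub_mem_unitSpan (k : ℕ) : 1 - x K ^ k * y K ^ k ∈ unitSpan K := by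
  induction k with
  | zero => simp
  | succ k ih =>
    have : 1 - x K ^ (k + 1) * y K ^ (k + 1) = (1 - x K ^ k * y K ^ k) + unit K k k := by
      simp only [unit, e, pow_succ (x K), pow_succ' (y K), mul_sub, sub_mul, mul_one, mul_assoc]
      abel
    rw [this]
    exact add_mem ih (unit_mem K k k)

variable {K} in
-- Right multiplication by a high power of `x` cancels every `y`, as for denominators in a
-- localisation.
theorem exists_mul_x_pow_eq_aeval (s : OneSidedInverseAlg K) :
    ∃ (k : ℕ) (p : Polynomial K), s * x K ^ k = Polynomial.aeval (x K) p := by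
  induction s using induction with
  | hc c => exact ⟨0, Polynomial.C c, by simp⟩
  | hx => exact ⟨0, Polynomial.X, by simp⟩
  | hy => exact ⟨1, 1, by simp [y_mul_x]⟩
  | hadd a b iha ihb =>
    obtain ⟨k, p, hp⟩ := iha
    obtain ⟨m, q, hq⟩ := ihb
    refine ⟨k + m, p * Polynomial.X ^ m + q * Polynomial.X ^ k, ?_⟩
    rw [add_mul, pow_add, ← mul_assoc, hp, ← pow_add, add_comm k, pow_add, ← mul_assoc, hq]
    simp
  | hmul a b iha ihb =>
    obtain ⟨k, p, hp⟩ := iha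
    obtain ⟨m, q, hq⟩ := ihb
    refine ⟨m + k, p * q, ?_⟩
    have : Polynomial.aeval (x K) q * x K ^ k = x K ^ k * Polynomial.aeval (x K) q := by
      have h := congrArg (Polynomial.aeval (x K)) (mul_comm q (Polynomial.X ^ k))
      simpa using h
    rw [pow_add, mul_assoc, ← mul_assoc b, hq, this, ← mul_assoc, hp, map_mul]

/-! ### The quotient `K[x, x⁻¹]` and its kernel -/

open LaurentPolynomial

/-- The canonical homomorphism `𝕊₁ → K[x, x⁻¹]`. -/
def toLaurent : OneSidedInverseAlg K →ₐ[K] K[T;T⁻¹] :=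
  lift (T 1) (T (-1)) (by rw [← T_add]; simp)

theorem toLaurent_aeval (p : Polynomial K) :
    toLaurent K (Polynomial.aeval (x K) p) = Polynomial.toLaurent p := by
  have h : (toLaurent K).comp (Polynomial.aeval (x K)) = Polynomial.toLaurentAlg := by
    apply Polynomial.algHom_ext
    simp [toLaurent, lift_x]
  exact DFunLike.congr_fun h p

theorem toLaurent_surjective : Function.Surjective (toLaurent K) := by
  intro f
  obtain ⟨n, p, hp⟩ := exists_T_pow f
  refine ⟨Polynomial.aeval (x K) p * y K ^ n, ?_⟩
  rw [map_mul, toLaurent_aeval, hp, map_pow, toLaurent, lift_y, T_pow, mul_assoc, ← T_add]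
  simp

variable {K} in
-- Since `K[X]` embeds in the Laurent polynomials, `s x^k = 0` for some `k`. Hence `s = s (1 - x^k
-- y^k)`, which lies in the span because the span is a left ideal.
theorem mem_unitSpan_of_toLaurent_eq_zero {s : OneSidedInverseAlg K} (h : toLaurent K s = 0) :
    s ∈ unitSpan K := by
  obtain ⟨k, p, hp⟩ := exists_mul_x_pow_eq_aeval s
  have h1 := congrArg (toLaurent K) hp
  rw [map_mul, h, zero_mul, toLaurent_aeval] at h1
  have h2 : p = 0 := Polynomial.toLaurent_injective (by rw [← h1, map_zero])
  rw [h2, map_zero] at hp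
  have h3 : s = s * (1 - x K ^ k * y K ^ k) := by
    rw [mul_sub, mul_one, ← mul_assoc, hp, zero_mul, sub_zero]
  rw [h3]
  exact mul_mem_unitSpan _ _ (one_sub_mem_unitSpan K k)

variable {K} in
-- Allowing every large `N` lets finitely many entries share one size.
theorem exists_sum_unit {s : OneSidedInverseAlg K} (h : s ∈ unitSpan K) :
    ∃ N₀, ∀ N ≥ N₀, ∃ c : Fin N → Fin N → K, s = ∑ a, ∑ b, c a b • unit K a b := by
  induction h using Submodule.span_induction with
  | mem t ht =>
    obtain ⟨⟨a, b⟩, rfl⟩ := ht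
    refine ⟨a + b + 1, fun N hN => ⟨fun p q => if p.1 = a ∧ q.1 = b then 1 else 0, ?_⟩⟩
    rw [Finset.sum_eq_single ⟨a, by omega⟩, Finset.sum_eq_single ⟨b, by omega⟩]
    · simp
    · intro q _ hq
      have : q.1 ≠ b := by simpa [Fin.ext_iff] using hq
      simp [this]
    · simp
    · intro p _ hp
      have : p.1 ≠ a := by simpa [Fin.ext_iff] using hp
      simp [this]
    · simp
  | zero => exact ⟨0, fun N _ => ⟨0, by simp⟩⟩
  | add s t _ _ ihs iht =>
    obtain ⟨A, hA⟩ := ihs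
    obtain ⟨B, hB⟩ := iht
    refine ⟨max A B, fun N hN => ?_⟩
    obtain ⟨c, hc⟩ := hA N (le_trans (le_max_left _ _) hN)
    obtain ⟨d, hd⟩ := hB N (le_trans (le_max_right _ _) hN)
    refine ⟨c + d, ?_⟩
    rw [hc, hd]
    simp [add_smul, Finset.sum_add_distrib]
  | smul r s _ ihs =>
    obtain ⟨A, hA⟩ := ihs
    refine ⟨A, fun N hN => ?_⟩
    obtain ⟨c, hc⟩ := hA N hN
    refine ⟨r • c, ?_⟩
    rw [hc]
    simp [Finset.smul_sum, mul_smul]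

/-! ### Finite matrices over `K` as matrices over the kernel -/

variable {K} {N : ℕ}

/-- The embedding of `N² × N²` matrices over `K` into the `N × N` matrices over `𝕊₁` with entries
in the span of the matrix units. -/
def blockMatrix (A : Matrix (Fin N × Fin N) (Fin N × Fin N) K) :
    Matrix (Fin N) (Fin N) (OneSidedInverseAlg K) :=
  Matrix.of fun i j => ∑ a : Fin N, ∑ b : Fin N, A (i, a) (j, b) • unit K a b

theorem blockMatrix_apply (A : Matrix (Fin N × Fin N) (Fin N × Fin N) K) (i j : Fin N) :
    blockMatrix A i j = ∑ a : Fin N, ∑ b : Fin N, A (i, a) (j, b) • unit K a b := rfl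

theorem blockMatrix_add (A B : Matrix (Fin N × Fin N) (Fin N × Fin N) K) :
    blockMatrix (A + B) = blockMatrix A + blockMatrix B := by
  ext i j
  simp [blockMatrix_apply, add_smul, Finset.sum_add_distrib]

theorem blockMatrix_zero :
    blockMatrix (0 : Matrix (Fin N × Fin N) (Fin N × Fin N) K) = 0 := by
  ext i j
  simp [blockMatrix_apply]

theorem unit_mul_unit (a b c d : ℕ) :
    unit K a b * unit K c d = if b = c then unit K a d else 0 := by
  have h : unit K a b * unit K c d = x K ^ a * (e K * y K ^ b * (x K ^ c * e K)) * y K ^ d := by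
    simp only [unit, mul_assoc]
  rw [h, e_mul_y_pow_mul_x_pow_mul_e]
  split_ifs
  · rfl
  · simp

theorem sum_unit_mul_sum_unit (A B : Fin N → Fin N → K) :
    (∑ a, ∑ b, A a b • unit K a b) * (∑ a, ∑ b, B a b • unit K a b) =
      ∑ a, ∑ b, ∑ c, (A a c * B c b) • unit K a b := by
  rw [Finset.sum_mul]
  refine Finset.sum_congr rfl fun a _ => ?_
  rw [Finset.sum_mul]
  symm
  rw [Finset.sum_comm]
  refine Finset.sum_congr rfl fun c _ => ?_
  symm
  rw [Finset.mul_sum, Finset.sum_eq_single c]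
  · rw [Finset.mul_sum]
    exact Finset.sum_congr rfl fun b _ => by
      rw [smul_mul_smul_comm, unit_mul_unit, if_pos rfl]
  · intro d _ hd
    rw [Finset.mul_sum]
    refine Finset.sum_eq_zero fun b _ => ?_
    rw [smul_mul_smul_comm, unit_mul_unit, if_neg (Fin.val_ne_of_ne hd.symm), smul_zero]
  · simp

theorem blockMatrix_mul (A B : Matrix (Fin N × Fin N) (Fin N × Fin N) K) :
    blockMatrix (A * B) = blockMatrix A * blockMatrix B := by
  ext i j
  rw [Matrix.mul_apply]
  simp only [blockMatrix_apply, sum_unit_mul_sum_unit fun a b => A (i, a) (_, b)]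
  symm
  rw [Finset.sum_comm]
  refine Finset.sum_congr rfl fun a _ => ?_
  rw [Finset.sum_comm]
  refine Finset.sum_congr rfl fun b _ => ?_
  rw [Matrix.mul_apply, Fintype.sum_prod_type, Finset.sum_smul]
  exact Finset.sum_congr rfl fun k _ => Finset.sum_smul.symm

/-- Compressing by matrix units isolates one scalar coefficient; with `e ≠ 0` this gives injectivity
of `blockMatrix`. -/
theorem unit_zero_mul_mul_unit (A : Matrix (Fin N × Fin N) (Fin N × Fin N) K)
    (i j a b : Fin N) : unit K 0 a * blockMatrix A i j * unit K b 0 = A (i, a) (j, b) • e K := by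
  have h0 : unit K 0 0 = e K := by simp [unit]
  simp only [blockMatrix_apply, Finset.sum_mul, Finset.mul_sum, mul_smul_comm, smul_mul_assoc,
    unit_mul_unit, Fin.val_inj, smul_ite, smul_zero, Finset.sum_ite_irrel,
    Finset.sum_const_zero, Finset.sum_ite_eq, Finset.sum_ite_eq', Finset.mem_univ, if_true, h0]

theorem blockMatrix_injective :
    Function.Injective (blockMatrix : Matrix (Fin N × Fin N) (Fin N × Fin N) K → _) := by
  intro A B h
  ext ⟨i, a⟩ ⟨j, b⟩
  have h1 := unit_zero_mul_mul_unit A i j a b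
  rw [h, unit_zero_mul_mul_unit] at h1
  exact (smul_left_injective K (e_ne_zero K) h1).symm

theorem blockMatrix_single (p q : Fin N × Fin N) (c : K) :
    blockMatrix (Matrix.single p q c) = Matrix.single p.1 q.1 (c • unit K p.2 q.2) := by
  ext i j
  obtain ⟨p, a⟩ := p
  obtain ⟨q, b⟩ := q
  simp only [blockMatrix_apply, Matrix.single_apply, Prod.mk.injEq]
  by_cases hi : p = i <;> by_cases hj : q = j <;>
    simp [hi, hj, ite_and, ite_smul, Finset.sum_ite_irrel]

variable (K N) in
/-- The monoid homomorphism `1 + A ↦ 1 + blockMatrix A`. -/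
def blockHom : Matrix (Fin N × Fin N) (Fin N × Fin N) K →*
    Matrix (Fin N) (Fin N) (OneSidedInverseAlg K) where
  toFun A := 1 + blockMatrix (A - 1)
  map_one' := by rw [sub_self, blockMatrix_zero, add_zero]
  map_mul' A B := by
    rw [show A * B - 1 = (A - 1) + (B - 1) + (A - 1) * (B - 1) by noncomm_ring,
      blockMatrix_add, blockMatrix_add, blockMatrix_mul]
    noncomm_ring

theorem blockHom_one_add (A : Matrix (Fin N × Fin N) (Fin N × Fin N) K) :
    blockHom K N (1 + A) = 1 + blockMatrix A := by
  change 1 + blockMatrix (1 + A - 1) = _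
  rw [add_sub_cancel_left]

theorem blockHom_injective : Function.Injective (blockHom K N) := fun _ _ h =>
  sub_left_injective (blockMatrix_injective (add_right_injective _ h))

end OneSidedInverseAlg

/-! ### An elementary matrix built from a one-sided inverse -/

namespace GLInf

open OneAddMInf

variable {R : Type*} [Ring R] {x y : R}

/-- If `y x = 1`, the matrix `[[x, x y - 1], [0, y]]` lies in `E_∞(R)`. -/
theorem exists_mem_E_of_mul_eq_one (h : y * x = 1) :
    ∃ w ∈ E R, (w : OneAddMInf R) = ofMatrix R 2 !![x, x * y - 1; 0, y] := by
  have h01 : (0 : ℕ) ≠ 1 := zero_ne_one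
  -- As in Whitehead's lemma, the first three factors give `[[1 - x y, x], [-y, 0]]` and the last
  -- three the rotation `[[0, -1], [1, 0]]`.
  refine ⟨elementary 0 1 h01 x * (elementary 1 0 h01.symm (-y) * (elementary 0 1 h01 x *
    (elementary 0 1 h01 (-1) * (elementary 1 0 h01.symm 1 * elementary 0 1 h01 (-1))))),
    mul_mem (elementary_mem _ _ _ _) (mul_mem (elementary_mem _ _ _ _)
    (mul_mem (elementary_mem _ _ _ _) (mul_mem (elementary_mem _ _ _ _)
    (mul_mem (elementary_mem _ _ _ _) (elementary_mem _ _ _ _))))), ?_⟩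
  have hu : ∀ r : R, oneAddSingle 0 1 r = ofMatrix _ 2 !![1, r; 0, 1] := by
    intro r
    refine (ofMatrix_one_add_single (n := 2) 0 1 r).symm.trans (congrArg _ ?_)
    ext i j; fin_cases i <;> fin_cases j <;> simp
  have hl : ∀ r : R, oneAddSingle 1 0 r = ofMatrix _ 2 !![1, 0; r, 1] := by
    intro r
    refine (ofMatrix_one_add_single (n := 2) 1 0 r).symm.trans (congrArg _ ?_)
    ext i j; fin_cases i <;> fin_cases j <;> simp
  simp only [Units.val_mul, coe_elementary, hu, hl, ← map_mul, Matrix.mul_fin_two]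
  congr 1
  ext i j
  fin_cases i <;> fin_cases j <;> simp [h]
  abel

/-- The commutator of `μ(u)` with the matrix `[[x, x y - 1], [0, y]]`. -/
theorem exists_oneAddSingle_mem_E (h : y * x = 1) (u : Rˣ) (hu : (u : R) * x = x * u) :
    ∃ g ∈ E R, (g : OneAddMInf R) = oneAddSingle 0 0 (((u : R) - 1) * (1 - x * y)) := by
  obtain ⟨w, hw, hw'⟩ := exists_mem_E_of_mul_eq_one h
  refine ⟨mu u * w * (mu u)⁻¹ * w⁻¹, mul_mem (E_normal.conj_mem w hw (mu u)) (inv_mem hw), ?_⟩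
  have h0 : ∀ r : R, oneAddSingle 0 0 r = ofMatrix _ 2 !![1 + r, 0; 0, 1] := by
    intro r
    refine (ofMatrix_one_add_single (n := 2) 0 0 r).symm.trans (congrArg _ ?_)
    ext i j; fin_cases i <;> fin_cases j <;> simp
  -- Stating the commutator identity without inverses avoids computing `w⁻¹`. It rests on `(1 - x y)
  -- x = 0` and `u x = x u`.
  have key : ((mu u * w : GLInf R) : OneAddMInf R) =
      oneAddSingle 0 0 (((u : R) - 1) * (1 - x * y)) * ((w * mu u : GLInf R) : OneAddMInf R) := by
    simp only [Units.val_mul, coe_mu, hw', h0, ← map_mul, Matrix.mul_fin_two]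
    congr 1
    have h' : ∀ z, y * (x * z) = z := fun z => by rw [← mul_assoc, h, one_mul]
    ext i j
    fin_cases i <;> fin_cases j <;> simp [mul_sub, sub_mul, add_mul, mul_assoc, hu, h']
    abel
  rw [mul_assoc, ← mul_inv_rev, Units.val_mul, key, mul_assoc, ← Units.val_mul, mul_inv_cancel,
    Units.val_one, mul_one]

end GLInf

/-! ### Invertible matrices over the identity are elementary -/

namespace OneSidedInverseAlg

open OneAddMInf GLInf

variable {K : Type*} [Field K]

theorem coe_muK (u : Kˣ) : (muK K u : OneAddMInf (OneSidedInverseAlg K)) =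
    oneAddSingle 0 0 (algebraMap K _ (u : K) - 1) := rfl

variable (N : ℕ)

/-- The matrices over `K` whose image under `blockHom` lies in `E_∞(𝕊₁)`. -/
def BlockMemE (A : Matrix (Fin N × Fin N) (Fin N × Fin N) K) : Prop :=
  ∃ g ∈ E (OneSidedInverseAlg K), (g : OneAddMInf (OneSidedInverseAlg K)) =
    ofMatrix _ N (blockHom K N A)

variable {N}

theorem BlockMemE.mul {A B : Matrix (Fin N × Fin N) (Fin N × Fin N) K} (hA : BlockMemE N A)
    (hB : BlockMemE N B) : BlockMemE N (A * B) := by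
  obtain ⟨g, hg, hg'⟩ := hA
  obtain ⟨h, hh, hh'⟩ := hB
  exact ⟨g * h, mul_mem hg hh, by rw [Units.val_mul, hg', hh', map_mul, map_mul]⟩

theorem BlockMemE.one : BlockMemE N (1 : Matrix (Fin N × Fin N) (Fin N × Fin N) K) :=
  ⟨1, one_mem _, by rw [map_one, map_one, Units.val_one]⟩

theorem BlockMemE.conj {A B C : Matrix (Fin N × Fin N) (Fin N × Fin N) K} (hA : BlockMemE N A)
    (hBC : B * C = 1) : BlockMemE N (B * A * C) := by
  obtain ⟨g, hg, hg'⟩ := hA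
  have hCB : C * B = 1 := mul_eq_one_comm.1 hBC
  let b : GLInf (OneSidedInverseAlg K) :=
    { val := ofMatrix _ N (blockHom K N B)
      inv := ofMatrix _ N (blockHom K N C)
      val_inv := by rw [← map_mul, ← map_mul, hBC, map_one, map_one]
      inv_val := by rw [← map_mul, ← map_mul, hCB, map_one, map_one] }
  refine ⟨b * g * b⁻¹, E_normal.conj_mem g hg b, ?_⟩
  rw [map_mul, map_mul, map_mul, map_mul, ← hg']
  rfl

theorem ofMatrix_blockHom_one_add_single (p q : Fin N × Fin N) (c : K) :
    ofMatrix _ N (blockHom K N (1 + Matrix.single p q c)) =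
      oneAddSingle (p.1 : ℕ) q.1 (c • unit K p.2 q.2) := by
  rw [blockHom_one_add, blockMatrix_single, ofMatrix_one_add_single]

theorem blockMemE_transvection_of_fst_ne {p q : Fin N × Fin N} (h : p.1 ≠ q.1) (c : K) :
    BlockMemE N (Matrix.transvection p q c) :=
  ⟨elementary p.1 q.1 (Fin.val_ne_of_ne h) (c • unit K p.2 q.2), elementary_mem _ _ _ _,
    (ofMatrix_blockHom_one_add_single p q c).symm⟩

/-- Indices in different blocks give an elementary matrix directly. Within one block, the
transvection is a commutator of two such through an index `r` in another block, whence `2 ≤ N`. -/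
theorem blockMemE_transvection (hN : 2 ≤ N) {p q : Fin N × Fin N} (h : p ≠ q) (c : K) :
    BlockMemE N (Matrix.transvection p q c) := by
  by_cases h1 : p.1 = q.1
  · have : Nontrivial (Fin N) := Fin.nontrivial_iff_two_le.2 hN
    obtain ⟨l, hl⟩ := exists_ne p.1
    set r : Fin N × Fin N := (l, p.2)
    have hpr : p.1 ≠ r.1 := hl.symm
    have hrq : r.1 ≠ q.1 := h1 ▸ hl
    have hpr' : p ≠ r := fun h => hpr (congrArg _ h)
    have hrq' : r ≠ q := fun h => hrq (congrArg _ h)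
    have key : Matrix.transvection p q c = Matrix.transvection p r c *
        Matrix.transvection r q 1 * Matrix.transvection p r (-c) *
        Matrix.transvection r q (-1) := by
      have hn : ∀ (a b : Fin N × Fin N) (d : K), Matrix.single a b (-d) = -Matrix.single a b d :=
        fun a b d => (Matrix.singleAddMonoidHom a b).map_neg d
      simp only [Matrix.transvection, add_mul, mul_add, one_mul, mul_one,
        Matrix.single_mul_single_same, Matrix.single_mul_single_of_ne _ _ _ _ hrq'.symm,
        Matrix.single_mul_single_of_ne _ _ _ _ hpr'.symm,
        Matrix.single_mul_single_of_ne _ _ _ _ h.symm, hn, mul_neg, neg_mul,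
        add_zero]
      abel
    rw [key]
    exact (((blockMemE_transvection_of_fst_ne hpr c).mul
      (blockMemE_transvection_of_fst_ne hrq 1)).mul
      (blockMemE_transvection_of_fst_ne hpr (-c))).mul (blockMemE_transvection_of_fst_ne hrq (-1))
  · exact blockMemE_transvection_of_fst_ne h1 c

/-- At position `(0, 0)` the matrix is `1 + (c - 1)(1 - x y) E₀₀`, the commutator found above. Other
positions follow by conjugating with a transposition, using normality of `E_∞`. -/
theorem blockMemE_one_add_single [NeZero N] (p : Fin N × Fin N) {c : K} (hc : c ≠ 0) :
    BlockMemE N (1 + Matrix.single p p (c - 1)) := by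
  have h0 : BlockMemE N (1 + Matrix.single (0, 0) (0, 0) (c - 1)) := by
    obtain ⟨g, hg, hg'⟩ := exists_oneAddSingle_mem_E (y_mul_x K)
      (Units.map (algebraMap K (OneSidedInverseAlg K) : K →* OneSidedInverseAlg K) (Units.mk0 c hc))
      (Algebra.commutes c (x K))
    refine ⟨g, hg, ?_⟩
    rw [hg', ofMatrix_blockHom_one_add_single, Algebra.smul_def, map_sub, map_one]
    simp [unit, e]
  set P : Matrix (Fin N × Fin N) (Fin N × Fin N) K := (Equiv.swap p (0, 0)).permMatrix K with hP
  have hPP : P * P = 1 := by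
    rw [hP, ← Matrix.permMatrix_mul, Equiv.swap_mul_self, Matrix.permMatrix_one]
  have key : 1 + Matrix.single p p (c - 1) =
      P * (1 + Matrix.single (0, 0) (0, 0) (c - 1)) * P := by
    rw [mul_add, add_mul, mul_one, hPP]
    congr 1
    rw [hP, Equiv.Perm.permMatrix, PEquiv.toMatrix_toPEquiv_mul, PEquiv.mul_toMatrix_toPEquiv]
    have hs : ∀ i, (0, 0) = Equiv.swap p (0, 0) i ↔ p = i := fun i => by
      rw [eq_comm, Equiv.swap_apply_eq_iff, Equiv.swap_apply_right, eq_comm]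
    ext i j
    simp [Matrix.single_apply, hs]
  rw [key]
  exact h0.conj hPP

theorem blockMemE_diagonal [NeZero N] (D : Fin N × Fin N → K) (hD : ∀ p, D p ≠ 0) :
    BlockMemE N (Matrix.diagonal D) := by
  classical
  suffices h : ∀ s : Finset (Fin N × Fin N),
      BlockMemE N (Matrix.diagonal fun p => if p ∈ s then D p else 1) by
    simpa using h Finset.univ
  intro s
  induction s using Finset.induction_on with
  | empty => simpa using BlockMemE.one
  | insert p s hp ih =>
    have key : (Matrix.diagonal fun q => if q ∈ insert p s then D q else 1) =
        (1 + Matrix.single p p (D p - 1)) * Matrix.diagonal fun q => if q ∈ s then D q else 1 := by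
      rw [← Matrix.diagonal_one, ← Matrix.diagonal_single, Matrix.diagonal_add,
        Matrix.diagonal_mul_diagonal]
      congr 1
      ext q
      rcases eq_or_ne q p with rfl | hq
      · simp [hp]
      · simp [hq]
    rw [key]
    exact (blockMemE_one_add_single p (hD p)).mul ih

theorem blockMemE_of_det_ne_zero (hN : 2 ≤ N) (A : Matrix (Fin N × Fin N) (Fin N × Fin N) K)
    (hA : A.det ≠ 0) : BlockMemE N A := by
  have : NeZero N := ⟨by omega⟩
  refine Matrix.diagonal_transvection_induction_of_det_ne_zero _ A hA (fun D hD => ?_)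
    (fun t => blockMemE_transvection hN t.hij t.c) (fun A B _ _ hA hB => hA.mul hB)
  rw [Matrix.det_diagonal, Finset.prod_ne_zero_iff] at hD
  exact blockMemE_diagonal D fun p => hD p (Finset.mem_univ p)

theorem exists_blockHom_eq {h : OneAddMInf (OneSidedInverseAlg K)}
    (hh : OneAddMInf.map (toLaurent K : OneSidedInverseAlg K →+* LaurentPolynomial K) h = 1) :
    ∃ N₀, ∀ N ≥ N₀, ∃ A, ofMatrix _ N (blockHom K N A) = h := by
  obtain ⟨n, hn⟩ := h.exists_level
  have hmem : ∀ i j, h.val i j - (1 : Matrix ℕ ℕ (OneSidedInverseAlg K)) i j ∈ unitSpan K := by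
    intro i j
    apply mem_unitSpan_of_toLaurent_eq_zero
    have h1 := congrFun (congrFun (congrArg OneAddMInf.val hh) i) j
    rw [map_val, val_one, Matrix.map_apply] at h1
    rw [map_sub, sub_eq_zero]
    refine h1.trans ?_
    simp only [Matrix.one_apply]
    split_ifs <;> simp
  choose f hf using fun i j => exists_sum_unit (hmem i j)
  -- The bound covers both the level of `h` and the sizes needed by the finitely many entries in its
  -- corner.
  refine ⟨max n ((Finset.range n ×ˢ Finset.range n).sup fun p => f p.1 p.2), fun N hN => ?_⟩
  have hc : ∀ i j : Fin N, ∃ c : Fin N → Fin N → K,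
      h.val i j - (1 : Matrix ℕ ℕ (OneSidedInverseAlg K)) i j = ∑ a, ∑ b, c a b • unit K a b := by
    intro i j
    by_cases hij : n ≤ (i : ℕ) ∨ n ≤ (j : ℕ)
    · exact ⟨0, by rw [hn _ _ hij]; simp⟩
    · push Not at hij
      refine hf i j N (le_trans ?_ (le_trans (le_max_right _ _) hN))
      exact Finset.le_sup (f := fun p : ℕ × ℕ => f p.1 p.2) (b := ((i : ℕ), (j : ℕ)))
        (by simpa using hij)
  choose c hc using hc
  refine ⟨1 + Matrix.of fun p q => c p.1 q.1 p.2 q.2, ?_⟩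
  have hl : Level N h.val := hn.mono (le_trans (le_max_left _ _) hN)
  rw [← ofMatrix_corner hl, blockHom_one_add]
  congr 1
  ext i j
  rw [Matrix.add_apply, blockMatrix_apply]
  simp only [Matrix.of_apply]
  rw [← hc i j, ← corner_one]
  simp [corner]

/-- `1 + M_∞(I)` is Dedekind finite, for `I` the kernel of `𝕊₁ → K[x, x⁻¹]`. -/
theorem mul_eq_one_symm {h h' : OneAddMInf (OneSidedInverseAlg K)}
    (hh : OneAddMInf.map (toLaurent K : OneSidedInverseAlg K →+* LaurentPolynomial K) h = 1)
    (hh' : OneAddMInf.map (toLaurent K : OneSidedInverseAlg K →+* LaurentPolynomial K) h' = 1)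
    (h1 : h * h' = 1) : h' * h = 1 := by
  obtain ⟨n, hn⟩ := exists_blockHom_eq hh
  obtain ⟨m, hm⟩ := exists_blockHom_eq hh'
  obtain ⟨A, rfl⟩ := hn (max n m) (le_max_left _ _)
  obtain ⟨B, rfl⟩ := hm (max n m) (le_max_right _ _)
  rw [← map_mul, ← map_mul] at h1 ⊢
  have h2 : A * B = 1 := blockHom_injective (ofMatrix_injective _ (by rw [h1, map_one, map_one]))
  rw [mul_eq_one_comm.1 h2, map_one, map_one]

/-- Both `g` and `g⁻¹` come from matrices over `K` of one common size. Injectivity of `blockHom`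
makes these mutually inverse, so the determinant is nonzero. -/
theorem mem_E_of_map_eq_one {g : GLInf (OneSidedInverseAlg K)}
    (hg : GLInf.map (toLaurent K : OneSidedInverseAlg K →+* LaurentPolynomial K) g = 1) :
    g ∈ E (OneSidedInverseAlg K) := by
  have hg' : GLInf.map (toLaurent K : OneSidedInverseAlg K →+* LaurentPolynomial K) g⁻¹ = 1 := by
    rw [map_inv, hg, inv_one]
  obtain ⟨n, hn⟩ := exists_blockHom_eq (congrArg Units.val hg)
  obtain ⟨m, hm⟩ := exists_blockHom_eq (congrArg Units.val hg')
  -- The summand `2` provides the second block required for transvections.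
  obtain ⟨A, hA⟩ := hn (n + m + 2) (by omega)
  obtain ⟨B, hB⟩ := hm (n + m + 2) (by omega)
  have h1 : ofMatrix _ _ (blockHom K _ (A * B)) = 1 := by
    rw [map_mul, map_mul, hA, hB, ← Units.val_mul, mul_inv_cancel, Units.val_one]
  have h2 : A * B = 1 := blockHom_injective (ofMatrix_injective _ (by rw [h1, map_one, map_one]))
  have hdet : A.det ≠ 0 := by
    intro h
    have h3 := congrArg Matrix.det h2
    rw [Matrix.det_mul, h, zero_mul, Matrix.det_one] at h3
    exact zero_ne_one h3
  obtain ⟨g', hg', h4⟩ := blockMemE_of_det_ne_zero (by omega) A hdet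
  have h5 : g' = g := Units.ext (h4.trans hA)
  rwa [← h5]

theorem eq_zero_of_x_pow_mul_y_pow {k : ℕ} (h : x K ^ k * y K ^ k = 1) : k = 0 := by
  cases k with
  | zero => rfl
  | succ k =>
    refine absurd ?_ (e_ne_zero K)
    have h1 : e K * (x K ^ (k + 1) * y K ^ (k + 1)) = 0 := by
      rw [pow_succ', mul_assoc, ← mul_assoc, e_mul_x, zero_mul]
    rwa [h, mul_one] at h1

/-! ### The index obstruction and the final decomposition -/

open LaurentPolynomial

/-- No invertible matrix over `𝕊₁` lifts `diag(x^k, 1, …)` with `k > 0`. -/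
theorem eq_zero_of_map_val_eq {g : GLInf (OneSidedInverseAlg K)} {k : ℕ}
    (hg : OneAddMInf.map (toLaurent K : OneSidedInverseAlg K →+* LaurentPolynomial K)
      (g : OneAddMInf (OneSidedInverseAlg K)) = oneAddSingle 0 0 (T (k : ℤ) - 1)) : k = 0 := by
  apply eq_zero_of_x_pow_mul_y_pow (K := K)
  set Y : OneAddMInf (OneSidedInverseAlg K) := oneAddSingle 0 0 (y K ^ k - 1) with hY
  set X : OneAddMInf (OneSidedInverseAlg K) := oneAddSingle 0 0 (x K ^ k - 1) with hX
  have hYX : Y * X = 1 := by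
    rw [hY, hX, oneAddSingle_mul_same, ← oneAddSingle_zero 0 0]
    congr 1
    rw [sub_mul, mul_sub, y_pow_mul_x_pow]
    noncomm_ring
  have hmY : OneAddMInf.map (toLaurent K : OneSidedInverseAlg K →+* LaurentPolynomial K) Y =
      oneAddSingle 0 0 (T (-(k : ℤ)) - 1) := by
    rw [hY, map_oneAddSingle]
    simp [toLaurent, lift_y, T_pow]
  have hmX : OneAddMInf.map (toLaurent K : OneSidedInverseAlg K →+* LaurentPolynomial K) X =
      oneAddSingle 0 0 (T (k : ℤ) - 1) := by
    rw [hX, map_oneAddSingle]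
    simp [toLaurent, lift_x, T_pow]
  set G := OneAddMInf.map (toLaurent K : OneSidedInverseAlg K →+* LaurentPolynomial K)
  have h1 : G ((g : OneAddMInf (OneSidedInverseAlg K)) * Y) = 1 := by
    rw [map_mul, hg, hmY, oneAddSingle_mul_same, ← oneAddSingle_zero 0 0]
    congr 1
    rw [sub_mul, mul_sub, ← T_add, add_neg_cancel, T_zero]
    ring
  have h2 : G (X * ((g⁻¹ : GLInf _) : OneAddMInf (OneSidedInverseAlg K))) = 1 := by
    rw [map_mul, hmX, ← hg, ← map_mul, ← Units.val_mul, mul_inv_cancel, Units.val_one, map_one]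
  -- Both `g Y` and `X g⁻¹` lie over `1`, and `(g Y)(X g⁻¹) = 1` because `Y X = 1`. Dedekind
  -- finiteness reverses the product, which then collapses to `X Y = 1`.
  have h3 := mul_eq_one_symm h1 h2 (by
    rw [mul_assoc, ← mul_assoc Y, hYX, one_mul, ← Units.val_mul, mul_inv_cancel, Units.val_one])
  rw [mul_assoc, ← mul_assoc _ _ Y, ← Units.val_mul, inv_mul_cancel, Units.val_one, one_mul, hX,
    hY, oneAddSingle_mul_same, ← oneAddSingle_zero 0 0] at h3
  have h4 := oneAddSingle_injective 0 0 h3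
  rw [sub_mul, mul_sub] at h4
  rw [← sub_eq_zero, ← h4]
  noncomm_ring

variable (K) in
/-- The unit `T n` of `K[T;T⁻¹]`. -/
def unitT (n : ℤ) : K[T;T⁻¹]ˣ where
  val := T n
  inv := T (-n)
  val_inv := by rw [← T_add, add_neg_cancel, T_zero]
  inv_val := by rw [← T_add, neg_add_cancel, T_zero]

/-- After clearing denominators in `u` and `u⁻¹`, the numerators multiply to a power of the prime
`X`, so each is a constant times a power of `X`. -/
theorem exists_eq_algebraMap_mul_unitT (u : K[T;T⁻¹]ˣ) :
    ∃ (a : Kˣ) (n : ℤ), u = Units.map (algebraMap K K[T;T⁻¹] : K →* K[T;T⁻¹]) a * unitT K n := by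
  obtain ⟨n, p, hp⟩ := exists_T_pow (u : K[T;T⁻¹])
  obtain ⟨m, q, hq⟩ := exists_T_pow ((u⁻¹ : K[T;T⁻¹]ˣ) : K[T;T⁻¹])
  have hpq : p * q = Polynomial.X ^ (n + m) := by
    apply Polynomial.toLaurent_injective
    rw [map_mul, hp, hq, Polynomial.toLaurent_X_pow, mul_mul_mul_comm, Units.mul_inv, one_mul,
      ← T_add, Nat.cast_add]
  obtain ⟨i, -, v, hv⟩ := (dvd_prime_pow Polynomial.prime_X (n + m)).1 (Dvd.intro q hpq)
  obtain ⟨c, hc, hcv⟩ := Polynomial.isUnit_iff.1 (v⁻¹).isUnit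
  have hp' : p = Polynomial.C c * Polynomial.X ^ i := by
    rw [hcv, ← hv, mul_comm, mul_assoc, Units.mul_inv, mul_one]
  refine ⟨hc.unit, i - n, Units.ext ?_⟩
  have h1 : (u : K[T;T⁻¹]) = Polynomial.toLaurent p * T (-n) := by
    rw [hp, mul_assoc, ← T_add, add_neg_cancel, T_zero, mul_one]
  rw [h1, hp', map_mul, Polynomial.toLaurent_C, Polynomial.toLaurent_X_pow, mul_assoc, ← T_add]
  rfl

/-- The obstruction treats only exponents `n ≥ 0`; negative ones are handled through `g⁻¹`. -/
theorem mem_E_of_map_eq_mu_unitT {g : GLInf (OneSidedInverseAlg K)} {n : ℤ}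
    (hg : GLInf.map (toLaurent K : OneSidedInverseAlg K →+* LaurentPolynomial K) g =
      mu (unitT K n)) :
    g ∈ E (OneSidedInverseAlg K) := by
  have hn : n = 0 := by
    obtain ⟨k, rfl | rfl⟩ := n.eq_nat_or_neg
    · rw [eq_zero_of_map_val_eq (congrArg Units.val hg), Nat.cast_zero]
    · have h : GLInf.map (toLaurent K : OneSidedInverseAlg K →+* LaurentPolynomial K) g⁻¹ =
          mu (unitT K k) := by
        rw [map_inv, hg, ← map_inv]
        congr 1
        apply Units.ext
        change T (-(-(k : ℤ))) = T (k : ℤ)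
        rw [neg_neg]
      rw [eq_zero_of_map_val_eq (congrArg Units.val h), Nat.cast_zero, neg_zero]
  apply mem_E_of_map_eq_one
  rw [hg, hn, show unitT K 0 = 1 from Units.ext T_zero, map_one]

theorem map_muK (a : Kˣ) :
    GLInf.map (toLaurent K : OneSidedInverseAlg K →+* LaurentPolynomial K) (muK K a) =
    mu (Units.map (algebraMap K K[T;T⁻¹] : K →* K[T;T⁻¹]) a) := by
  apply Units.ext
  rw [coe_map, coe_muK, coe_mu, map_oneAddSingle]
  simp

theorem exists_inv_muK_mul_mem_E (g : GLInf (OneSidedInverseAlg K)) :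
    ∃ a : Kˣ, (muK K a)⁻¹ * g ∈ E (OneSidedInverseAlg K) := by
  obtain ⟨u, hu⟩ := exists_mk_eq_mk_mu (LaurentPolynomial.hasPairReduction K)
    (GLInf.map (toLaurent K : OneSidedInverseAlg K →+* LaurentPolynomial K) g)
  obtain ⟨a, n, rfl⟩ := exists_eq_algebraMap_mul_unitT u
  obtain ⟨e, he, he'⟩ := exists_mem_E_map_eq
    (f := (toLaurent K : OneSidedInverseAlg K →+* LaurentPolynomial K)) (toLaurent_surjective K)
    (QuotientGroup.eq.1 hu)
  -- The lifted correction `e` makes `(muK a)⁻¹ g e` map to `mu (unitT K n)`, and removing `e` does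
  -- not affect membership in `E_∞`.
  refine ⟨a, (Subgroup.mul_mem_cancel_right _ he).1 (mem_E_of_map_eq_mu_unitT (n := n) ?_)⟩
  rw [map_mul, map_mul, he', map_inv, map_muK, map_mul]
  group

/-- The character `x, y ↦ 1` fixes scalars, which carries the question to the commutative ring `K`,
where the determinant decides. -/
theorem eq_one_of_muK_mem_E {a : Kˣ} (h : muK K a ∈ E (OneSidedInverseAlg K)) : a = 1 := by
  have h1 := map_mem_E (lift (K := K) (1 : K) 1 (one_mul 1) : OneSidedInverseAlg K →+* K) h
  have h2 := eq_one_of_mu_mem_E (u := a) (by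
    convert h1
    apply Units.ext
    rw [coe_map, coe_muK, coe_mu, map_oneAddSingle]
    simp)
  exact h2

end OneSidedInverseAlg

end

theorem mainTheorem2 (K : Type*) [Field K] :
    -- the natural map `U(K) → K₁(𝕊₁)` is an isomorphism
    (∃ φ : UK K ≃* K1 (OneSidedInverseAlg K),
      ∀ u : UK K, φ u = QuotientGroup.mk (u : GLInf (OneSidedInverseAlg K))) ∧
    -- the natural map `K* → U(K)` is an isomorphism
    (∃ ψ : Kˣ ≃* UK K, ∀ a : Kˣ, (ψ a : GLInf (OneSidedInverseAlg K)) = muK K a) ∧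
    -- `GL_∞(𝕊₁)` is the internal semidirect product `U(K) ⋉ E_∞(𝕊₁)`
    (GLInf.E (OneSidedInverseAlg K)).Normal ∧
    Subgroup.IsComplement' (UK K) (GLInf.E (OneSidedInverseAlg K)) := by
  refine ⟨⟨MulEquiv.ofBijective ((QuotientGroup.mk' (GLInf.E (OneSidedInverseAlg K))).comp
    (UK K).subtype) ⟨?_, ?_⟩, fun u => rfl⟩, ⟨MonoidHom.ofInjective (f := muK K) ?_, fun a => rfl⟩,
    GLInf.E_normal, Subgroup.isComplement'_of_disjoint_and_mul_eq_univ ?_ ?_⟩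
  · rw [injective_iff_map_eq_one]
    rintro ⟨_, a, rfl⟩ h
    have ha := OneSidedInverseAlg.eq_one_of_muK_mem_E ((QuotientGroup.eq_one_iff _).1 h)
    subst ha
    exact Subtype.ext (map_one _)
  · intro q
    obtain ⟨g, rfl⟩ := QuotientGroup.mk_surjective q
    obtain ⟨a, ha⟩ := OneSidedInverseAlg.exists_inv_muK_mul_mem_E g
    exact ⟨⟨muK K a, a, rfl⟩, QuotientGroup.eq.2 ha⟩
  · rw [injective_iff_map_eq_one]
    exact fun a ha => OneSidedInverseAlg.eq_one_of_muK_mem_E (ha ▸ one_mem _)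
  · rw [Subgroup.disjoint_def]
    rintro _ ⟨a, rfl⟩ h
    rw [OneSidedInverseAlg.eq_one_of_muK_mem_E h, map_one]
  · rw [Set.eq_univ_iff_forall]
    intro g
    obtain ⟨a, ha⟩ := OneSidedInverseAlg.exists_inv_muK_mul_mem_E g
    exact ⟨muK K a, ⟨a, rfl⟩, _, ha, mul_inv_cancel_left _ _⟩
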